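/- Let $d\ge 1$, $T>0$, $\lambda\in(0,2)$, $c_\lambda>0$, and $Q_T=\mathbb{R}^d\times(0,T)$. Let $f:\mathbb{R}\to\mathbb{R}^d$ and $A:\mathbb{R}\to\mathbb{R}$ be Lipschitz continuous, with $A$ non-decreasing and $A(0)=0$. Consider the Cauchy problem $$\partial_t u+\nabla\cdot f(u)=-(-\Delta)^{\lambda/2}A(u)\ \text{ in } Q_T,\qquad u(x,0)=u_0(x)\ \text{ in }\mathbb{R}^d, \qquad (1)$$ where $-(-\Delta)^{\lambda/2}\phi(x)=c_\lambda\,\mathrm{P.V.}\int_{|z|>0}\frac{\phi(x+z)-\phi(x)}{|z|^{d+\lambda}}\,dz$. For $r>0$ put $$g_r[\varphi](x)=c_\lambda\lim_{b\to0^+}\int_{b<|z|<r}\frac{\varphi(x+z)-\varphi(x)}{|z|^{d+\lambda}}\,dz,\qquad g^r[\varphi](x)=c_\lambda\int_{|z|>r}\frac{\varphi(x+z)-\varphi(x)}{|z|^{d+\lambda}}\,dz,$$ and for $k\in\mathbb{R}$ let $\eta_k(u)=|u-k|$, $\eta_k'(u)=\operatorname{sgn}(u-k)$ (with $\operatorname{sgn}(0)=0$)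 and $q_k(u)=\eta_k'(u)(f(u)-f(k))$. A function $u$ is called an entropy solution of (1) if (i) $u\in L^\infty(Q_T)\cap C([0,T];L^1(\mathbb{R}^d))$; (ii) for all $k\in\mathbb{R}$, all $r>0$ and all nonnegative $\varphi\in C_c^\infty(Q_T)$, $$\iint_{Q_T}\eta_k(u)\,\partial_t\varphi+q_k(u)\cdot\nabla\varphi+\eta_{A(k)}(A(u))\,g_r[\varphi]+\eta_k'(u)\,g^r[A(u)]\,\varphi\;dx\,dt\ \ge 0,$$ where $\nabla$, $g_r$ and $g^r$ act in the variable $x$; (iii) $u(\cdot,0)=u_0$ a.e. in $\mathbb{R}^d$. Then the following hold. ($L^1$-contraction) If $u$ and $v$ are entropy solutions of (1) with initial data $u_0$ and $v_0$ respectively, then for all $t\in(0,T)$, $$\|u(\cdot,t)-v(\cdot,t)\|_{L^1(\mathbb{R}^d)}\le\|u_0-v_0\|_{L^1(\mathbb{R}^d)}.$$ (Uniqueness) For given initial data $u_0$ there is at most one entropy solution of (1): if $u$ and $v$ are entropy solutions with the same initial data $u_0$, then $u=v$ a.e. on $Q_T$, and $u(\cdot,t)=v(\cdot,t)$ a.e.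 in $\mathbb{R}^d$ for every $t\in[0,T]$. -/

import Mathlib

open MeasureTheory Filter Topology Set
open scoped NNReal ENNReal ContDiff

noncomputable section

namespace FracConvDiff

/-- Euclidean space `ℝ^d`. -/
abbrev Space (d : ℕ) : Type := EuclideanSpace ℝ (Fin d)

/-- The space-time cylinder `Q_T = ℝ^d × (0,T)`. -/
def cylinder (d : ℕ) (T : ℝ) : Set (Space d × ℝ) := univ ×ˢ Ioo 0 T

/-- The singular part of the fractional Laplacian,
`g_r[φ](x) = c P.V. ∫_{|z|<r} (φ(x+z) - φ(x)) / |z|^(d+λ) dz`,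
the principal value being the limit of the integrals over `b < |z| < r` as `b → 0+`. -/
def gInner {d : ℕ} (c lam r : ℝ) (φ : Space d → ℝ) (x : Space d) : ℝ :=
  c * limUnder (𝓝[>] (0 : ℝ)) fun b : ℝ =>
    ∫ z in {z : Space d | b < ‖z‖ ∧ ‖z‖ < r}, (φ (x + z) - φ x) / ‖z‖ ^ ((d : ℝ) + lam)

/-- The regular part of the fractional Laplacian,
`g^r[φ](x) = c ∫_{|z|>r} (φ(x+z) - φ(x)) / |z|^(d+λ) dz`. -/
def gOuter {d : ℕ} (c lam r : ℝ) (φ : Space d → ℝ) (x : Space d) : ℝ :=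
  c * ∫ z in {z : Space d | r < ‖z‖}, (φ (x + z) - φ x) / ‖z‖ ^ ((d : ℝ) + lam)

/-- The Kružkov entropy `η_k(u) = |u - k|`. -/
def eta (k u : ℝ) : ℝ := |u - k|

/-- The derivative of the Kružkov entropy, `η'_k(u) = sgn(u - k)` with `sgn 0 = 0`. -/
def eta' (k u : ℝ) : ℝ := Real.sign (u - k)

/-- The entropy flux `q_k(u) = η'_k(u) (f(u) - f(k))`. -/
def flux {d : ℕ} (f : ℝ → Space d) (k u : ℝ) : Space d := eta' k u • (f u - f k)

/-- Nonnegative test functions `φ ∈ C_c^∞(Q_T)`, extended by zero to `ℝ^d × ℝ`. -/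
structure IsNonnegTest {d : ℕ} (T : ℝ) (φ : Space d × ℝ → ℝ) : Prop where
  smooth : ContDiff ℝ ∞ φ
  compact : HasCompactSupport φ
  support_subset : tsupport φ ⊆ cylinder d T
  nonneg : ∀ p, 0 ≤ φ p

/-- The function `u(x,t)` belongs to `C([0,T]; L^1(ℝ^d))`. -/
def MemCL1 {d : ℕ} (T : ℝ) (u : Space d → ℝ → ℝ) : Prop :=
  (∀ t ∈ Icc 0 T, MemLp (fun x => u x t) 1 volume) ∧
  ∀ t ∈ Icc 0 T,
    Tendsto (fun s => eLpNorm (fun x => u x s - u x t) 1 volume) (𝓝[Icc 0 T] t) (𝓝 0)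

/-- The integrand of the entropy inequality at the point `(x,t)`. -/
def entropyIntegrand {d : ℕ} (c lam : ℝ) (f : ℝ → Space d) (A : ℝ → ℝ)
    (u : Space d → ℝ → ℝ) (k r : ℝ) (φ : Space d × ℝ → ℝ) (x : Space d) (t : ℝ) : ℝ :=
  eta k (u x t) * deriv (fun s => φ (x, s)) t
    + inner ℝ (flux f k (u x t)) (gradient (fun y => φ (y, t)) x)
    + eta (A k) (A (u x t)) * gInner c lam r (fun y => φ (y, t)) x
    + eta' k (u x t) * gOuter c lam r (fun y => A (u y t)) x * φ (x, t)

/-- `u` is an entropy solution of `∂ₜu + ∇·f(u) = -(-Δ)^(λ/2) A(u)` in `Q_T` with initial datum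
`u₀`, where `c` is the constant in the definition of the fractional Laplacian. -/
structure IsEntropySolution {d : ℕ} (c lam T : ℝ) (f : ℝ → Space d) (A : ℝ → ℝ)
    (u₀ : Space d → ℝ) (u : Space d → ℝ → ℝ) : Prop where
  memLinfty : MemLp (fun p : Space d × ℝ => u p.1 p.2) ∞ (volume.restrict (cylinder d T))
  memCL1 : MemCL1 T u
  entropy_ineq : ∀ k r : ℝ, 0 < r → ∀ φ : Space d × ℝ → ℝ, IsNonnegTest T φ →
    0 ≤ ∫ p in cylinder d T, entropyIntegrand c lam f A u k r φ p.1 p.2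
  initial : ∀ᵐ x, u x 0 = u₀ x

end FracConvDiff

end

/-! The proof is Kružkov's doubling of variables, adapted to a Lévy operator. The entropy inequality
for `U` is taken at level `k = V q`, that for `V` at level `k = U p`, both are tested with one
function `Φ(p, q)`, integrated over the other variable and added.

The operator is split at radius `r`. Its singular part acts on `Φ` in one variable only and costs at
most a constant times `∫_{|z|<r} |z|²`, which vanishes as `r → 0`
(`IsKruzkov.exists_integral_doublingIntegrand_ge`). The two regular parts combine into a jump
operator that moves `p` and `q` by the same `z`: since `A` is monotone, `sgn(u - v)` times the
difference of the jumps of `A(u)` and `A(v)` is at most the jump of `|A(u) - A(v)|`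
(`sign_mul_jump_le`). That operator is bounded, so it can be transposed onto `Φ`
(`integral_jump_mul`), which gives `IsKruzkov.doubling`.

With `Φ(p, q) = ρ(p - q) ψ(p)`, diagonal jumps and diagonal derivatives leave `ρ(p - q)` unchanged
and act on `ψ` alone, so the limit `r → 0` meets no singularity of the mollifier
(`IsKruzkov.mollified`). While `ρ` stays fixed, `ψ` is a dilated space cutoff times `Θ(t)`; as the
cutoff widens, the flux and nonlocal terms vanish because `|U p - V q| ρ(p - q)` is integrable
(`IsKruzkov.integral_mollified_nonneg`). Only then is `ρ` concentrated, and continuity of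
translations in `L¹` gives `∫ |U - V| Θ'(t) ≥ 0` (`IsKruzkov.integral_deriv_mul_nonneg`).

Thus the continuous function `t ↦ ‖u(t) - v(t)‖₁` is nonincreasing on `(0, T)`; continuity at `0`
gives the contraction, and uniqueness follows. -/

noncomputable section

namespace FracConvDiff

/-! ### The Lévy measure of the fractional Laplacian -/

section Levy

variable {d : ℕ} {c lam : ℝ}

/-- The density `c |z|^(-d-λ)` of the Lévy measure of the fractional Laplacian. -/
def levyDensity (d : ℕ) (c lam : ℝ) (z : Space d) : ℝ := c / ‖z‖ ^ ((d : ℝ) + lam)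

/-- The Lévy measure `c |z|^(-d-λ) dz` of the fractional Laplacian. -/
def levy (d : ℕ) (c lam : ℝ) : Measure (Space d) :=
  volume.withDensity fun z => ENNReal.ofReal (levyDensity d c lam z)

instance : SFinite (levy d c lam) := by unfold levy; infer_instance

lemma measurable_levyDensity : Measurable (levyDensity d c lam) := by
  unfold levyDensity; fun_prop

lemma levyDensity_nonneg (hc : 0 < c) (z : Space d) : 0 ≤ levyDensity d c lam z := by
  unfold levyDensity; positivity

/-- The density is even. This symmetry is what lets first differences be replaced by second
differences. -/
instance : (levy d c lam).IsNegInvariant := by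
  refine ⟨?_⟩
  rw [Measure.neg]
  ext s hs
  rw [Measure.map_apply measurable_neg hs, levy, withDensity_apply _ hs,
    withDensity_apply _ (measurable_neg hs), ← lintegral_indicator hs,
    ← lintegral_indicator (measurable_neg hs), ← lintegral_neg_eq_self]
  congr 1
  ext z
  by_cases h : z ∈ s <;> simp [Set.indicator, h, levyDensity]

lemma setIntegral_levy (hc : 0 < c) {s : Set (Space d)} (hs : MeasurableSet s)
    (g : Space d → ℝ) :
    ∫ z in s, g z ∂(levy d c lam) = c * ∫ z in s, g z / ‖z‖ ^ ((d : ℝ) + lam) := by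
  rw [levy, setIntegral_withDensity_eq_setIntegral_toReal_smul
    measurable_levyDensity.ennreal_ofReal (by simp) _ hs, ← integral_const_mul]
  congr 1
  ext z
  rw [ENNReal.toReal_ofReal (levyDensity_nonneg hc z), levyDensity, smul_eq_mul]
  ring

/-- The Lévy measure integrates `min 1 |z|²`. -/
lemma integrable_min_levy (hd : 0 < d) (hlam : lam ∈ Ioo (0 : ℝ) 2) (hc : 0 < c) :
    Integrable (fun z => min 1 (‖z‖ ^ 2)) (levy d c lam) := by
  have : Nonempty (Fin d) := ⟨⟨0, hd⟩⟩
  rw [levy, integrable_withDensity_iff_integrable_smul' measurable_levyDensity.ennreal_ofReal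
    (by simp)]
  simp only [ENNReal.toReal_ofReal (levyDensity_nonneg hc _)]
  simp only [levyDensity]
  rw [integrable_fun_norm_addHaar (μ := (volume : Measure (Space d)))
    (f := fun y => (c / y ^ ((d : ℝ) + lam)) • min 1 (y ^ 2))]
  have hdim : Module.finrank ℝ (Space d) = d := by simp
  rw [hdim, ← Ioc_union_Ioi_eq_Ioi zero_le_one]
  -- In polar coordinates the Jacobian reduces the density to `c y^(-1-λ)`: against `y²` it is
  -- integrable at `0` because `λ < 2`, and by itself at infinity because `λ > 0`.
  have key : ∀ y : ℝ, 0 < y → y ^ (d - 1) * (c / y ^ ((d : ℝ) + lam)) = c * y ^ (-1 - lam) := by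
    intro y hy
    have : (y ^ (d - 1) : ℝ) = y ^ ((d : ℝ) - 1) := by
      rw [← Real.rpow_natCast, Nat.cast_sub hd, Nat.cast_one]
    rw [this, div_eq_mul_inv, ← Real.rpow_neg hy.le, mul_left_comm, ← Real.rpow_add hy]
    congr 2; ring
  refine IntegrableOn.union ?_ ?_
  · have h1 : IntegrableOn (fun y : ℝ => c * y ^ (1 - lam)) (Ioc 0 1) := by
      have := (intervalIntegral.intervalIntegrable_rpow' (a := 0) (b := 1) (r := 1 - lam)
        (by linarith [hlam.2]))
      rw [intervalIntegrable_iff_integrableOn_Ioc_of_le zero_le_one] at this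
      exact this.const_mul c
    refine h1.congr_fun (fun y hy => ?_) measurableSet_Ioc
    have hy2 : y ^ 2 ≤ 1 := pow_le_one₀ hy.1.le hy.2
    simp only [smul_eq_mul, min_eq_right hy2]
    rw [← mul_assoc, key y hy.1, mul_assoc, ← Real.rpow_natCast, ← Real.rpow_add hy.1]
    congr 2; push_cast; ring
  · have h1 : IntegrableOn (fun y : ℝ => c * y ^ (-1 - lam)) (Ioi 1) :=
      (integrableOn_Ioi_rpow_of_lt (by linarith [hlam.1]) one_pos).const_mul c
    refine h1.congr_fun (fun y (hy : 1 < y) => ?_) measurableSet_Ioi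
    have hy2 : 1 ≤ y ^ 2 := one_le_pow₀ hy.le
    simp only [smul_eq_mul, min_eq_left hy2]
    rw [← key y (by linarith)]; ring

end Levy

/-! ### Quadratic bound on second differences -/

section SecondDifference

variable {E : Type*} [NormedAddCommGroup E] [NormedSpace ℝ E]

/-- The symmetric second difference of `g` at `p` in direction `h`, divided by two. -/
def secondDiff (g : E → ℝ) (p h : E) : ℝ := (g (p + h) + g (p - h) - 2 * g p) / 2

/-- The map `y ↦ g (p + y) + g (p - y)` has derivative `Dg(p + y) - Dg(p - y)`, of size at most
`2K‖y‖` with `K` a Lipschitz constant of `Dg`; the mean value inequality on the ball of radius `‖h‖`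
concludes. The constant does not depend on `p`. -/
lemma exists_abs_secondDiff_le {g : E → ℝ} (hg : ContDiff ℝ ∞ g) (hgc : HasCompactSupport g) :
    ∃ C : ℝ, 0 ≤ C ∧ ∀ p h, |secondDiff g p h| ≤ C * ‖h‖ ^ 2 := by
  have hD : ContDiff ℝ 1 (fderiv ℝ g) := (contDiff_infty.1 hg 2).fderiv_right (by norm_num)
  obtain ⟨K, hK⟩ := ContDiff.lipschitzWith_of_hasCompactSupport (hgc.fderiv ℝ) hD one_ne_zero
  refine ⟨K, K.2, fun p h => ?_⟩
  have hdiff : Differentiable ℝ g := hg.differentiable (by simp)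
  have hder : ∀ y ∈ Metric.closedBall (0 : E) ‖h‖,
      HasFDerivWithinAt (fun y => g (p + y) + g (p - y))
        (fderiv ℝ g (p + y) - fderiv ℝ g (p - y)) (Metric.closedBall 0 ‖h‖) y := by
    intro y _
    have h1 : HasFDerivAt (fun y => g (p + y)) (fderiv ℝ g (p + y)) y := by
      exact (hdiff (p + y)).hasFDerivAt.comp y ((hasFDerivAt_id y).const_add p)
    have h2 : HasFDerivAt (fun y => g (p - y)) (-fderiv ℝ g (p - y)) y := by
      simpa [Function.comp_def] using
        (hdiff (p - y)).hasFDerivAt.comp y ((hasFDerivAt_id y).const_sub p)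
    rw [sub_eq_add_neg]
    exact (h1.add h2).hasFDerivWithinAt
  have hb : ∀ y ∈ Metric.closedBall (0 : E) ‖h‖,
      ‖fderiv ℝ g (p + y) - fderiv ℝ g (p - y)‖ ≤ 2 * K * ‖h‖ := by
    intro y hy
    have := hK.dist_le_mul (p + y) (p - y)
    rw [dist_eq_norm, dist_eq_norm] at this
    have h3 : p + y - (p - y) = (2 : ℝ) • y := by rw [two_smul]; abel
    rw [h3, norm_smul] at this
    have hy' : ‖y‖ ≤ ‖h‖ := by simpa using hy
    have hK0 : (0 : ℝ) ≤ K := K.2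
    norm_num at this
    nlinarith
  have := (convex_closedBall (0 : E) ‖h‖).norm_image_sub_le_of_norm_hasFDerivWithin_le
    hder hb (x := 0) (y := h) (by simp) (by simp)
  simp only [add_zero, sub_zero, Real.norm_eq_abs] at this
  rw [secondDiff, abs_div, abs_of_pos (two_pos : (0 : ℝ) < 2), div_le_iff₀ two_pos]
  rw [show g (p + h) + g (p - h) - 2 * g p = g (p + h) + g (p - h) - (g p + g p) by ring]
  exact this.trans_eq (by ring)

end SecondDifference

/-! ### Integrals against a symmetric Lévy measure and the principal value -/

section LevyIntegrals

variable {d : ℕ} {ν : Measure (Space d)}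

lemma measurableSet_normBall (r : ℝ) : MeasurableSet {z : Space d | ‖z‖ < r} :=
  measurableSet_lt measurable_norm measurable_const

lemma measurableSet_normOuter (r : ℝ) : MeasurableSet {z : Space d | r < ‖z‖} :=
  measurableSet_lt measurable_const measurable_norm

lemma measure_normOuter_lt_top (hν : Integrable (fun z => min 1 (‖z‖ ^ 2)) ν) {r : ℝ}
    (hr : 0 < r) : ν {z | r < ‖z‖} < ⊤ := by
  have h : 0 < min 1 (r ^ 2) := by positivity
  refine (measure_mono fun z (hz : r < ‖z‖) => ?_).trans_lt (hν.measure_ge_lt_top h)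
  exact min_le_min le_rfl (pow_le_pow_left₀ hr.le hz.le 2)

lemma integrableOn_normBall_sq (hν : Integrable (fun z => min 1 (‖z‖ ^ 2)) ν) (r : ℝ) :
    IntegrableOn (fun z => ‖z‖ ^ 2) {z | ‖z‖ < r} ν := by
  refine ((hν.const_mul (max 1 (r ^ 2))).integrableOn (s := {z | ‖z‖ < r})).mono'
    (by fun_prop) ?_
  refine (ae_restrict_iff' (measurableSet_normBall r)).2 (ae_of_all _ fun z (hz : ‖z‖ < r) => ?_)
  rw [Real.norm_of_nonneg (by positivity)]
  rcases le_total (‖z‖ ^ 2) 1 with h | h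
  · rw [min_eq_right h]
    exact le_mul_of_one_le_left (by positivity) (le_max_left _ _)
  · rw [min_eq_left h, mul_one]
    exact (pow_le_pow_left₀ (norm_nonneg _) hz.le 2).trans (le_max_right _ _)

/-- Dominated convergence: for `z ≠ 0` the indicator is eventually zero, and at `z = 0` the
integrand vanishes, so an atom of `ν` at the origin is harmless. This is the rate at which the
singular part of the operator disappears. -/
lemma tendsto_setIntegral_normBall_sq (hν : Integrable (fun z => min 1 (‖z‖ ^ 2)) ν) :
    Tendsto (fun r : ℝ => ∫ z in {z | ‖z‖ < r}, ‖z‖ ^ 2 ∂ν) (𝓝[>] 0) (𝓝 0) := by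
  have hlim : Tendsto (fun r : ℝ => ∫ z, {z : Space d | ‖z‖ < r}.indicator (fun z => ‖z‖ ^ 2) z ∂ν)
      (𝓝[>] 0) (𝓝 (∫ _, (0 : ℝ) ∂ν)) := by
    refine tendsto_integral_filter_of_dominated_convergence
      ({z : Space d | ‖z‖ < 1}.indicator fun z => ‖z‖ ^ 2) ?_ ?_ ?_ ?_
    · exact .of_forall fun r =>
        ((by fun_prop : Measurable fun z : Space d => ‖z‖ ^ 2).indicator
          (measurableSet_normBall r)).aestronglyMeasurable
    · filter_upwards [Ioo_mem_nhdsGT one_pos] with r hr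
      refine ae_of_all _ fun z => ?_
      rw [Real.norm_of_nonneg (indicator_nonneg (fun _ _ => by positivity) _)]
      exact indicator_le_indicator_of_subset (fun z (hz : ‖z‖ < r) => hz.trans hr.2)
        (fun _ => by positivity) z
    · exact (integrable_indicator_iff (measurableSet_normBall 1)).2 (integrableOn_normBall_sq hν 1)
    · refine ae_of_all _ fun z => ?_
      rcases eq_or_ne z 0 with rfl | hz
      · refine tendsto_const_nhds.congr fun r => ?_
        simp [indicator]
      · refine tendsto_const_nhds.congr' ?_
        filter_upwards [Ioo_mem_nhdsGT (norm_pos_iff.2 hz)] with r hr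
        rw [indicator_of_notMem]
        exact fun h : ‖z‖ < r => lt_asymm h hr.2
  simp only [integral_zero, integral_indicator (measurableSet_normBall _)] at hlim
  exact hlim

/-- Average the integral with its image under `z ↦ -z`. -/
lemma integral_symm_diff [ν.IsNegInvariant] {s : Set (Space d)} (hs : MeasurableSet s)
    (hneg : ∀ z, -z ∈ s ↔ z ∈ s) {g : Space d → ℝ} {x : Space d}
    (hg : IntegrableOn (fun z => g (x + z) - g x) s ν) :
    IntegrableOn (secondDiff g x) s ν ∧
      ∫ z in s, (g (x + z) - g x) ∂ν = ∫ z in s, secondDiff g x z ∂ν := by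
  set h : Space d → ℝ := s.indicator fun z => g (x + z) - g x with hh
  have hi : Integrable h ν := (integrable_indicator_iff hs).2 hg
  have hi' : Integrable (fun z => h (-z)) ν := hi.comp_neg
  have hsum : s.indicator (secondDiff g x) = fun z => (h z + h (-z)) / 2 := by
    ext z
    by_cases hz : z ∈ s
    · have hz' := (hneg z).2 hz
      simp only [hh, indicator_of_mem hz, indicator_of_mem hz', secondDiff, ← sub_eq_add_neg]
      ring
    · have hz' := mt (hneg z).1 hz
      simp [hh, indicator_of_notMem hz, indicator_of_notMem hz']
  constructor
  · rw [← integrable_indicator_iff hs, hsum]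
    exact (hi.add hi').div_const 2
  · rw [← integral_indicator hs, ← integral_indicator hs, hsum, integral_div,
      integral_add hi hi', integral_neg_eq_self h ν]
    ring

/-- This is why the principal value exists: on each annulus the first difference may be symmetrised,
and the second difference is dominated by `C |z|²`, integrable up to the origin. -/
lemma tendsto_integral_annulus [ν.IsNegInvariant]
    (hν : Integrable (fun z => min 1 (‖z‖ ^ 2)) ν) {g : Space d → ℝ} (hg : Continuous g)
    {C M : ℝ} (hM : ∀ x, |g x| ≤ M) {x : Space d} (hC : ∀ z, |secondDiff g x z| ≤ C * ‖z‖ ^ 2)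
    (r : ℝ) :
    Tendsto (fun b : ℝ => ∫ z in {z | b < ‖z‖ ∧ ‖z‖ < r}, (g (x + z) - g x) ∂ν) (𝓝[>] 0)
      (𝓝 (∫ z in {z | ‖z‖ < r}, secondDiff g x z ∂ν)) := by
  have hms : ∀ b : ℝ, MeasurableSet {z : Space d | b < ‖z‖ ∧ ‖z‖ < r} := fun b =>
    (measurableSet_normOuter b).inter (measurableSet_normBall r)
  have hsd : Measurable (secondDiff g x) := by
    have := hg.measurable; unfold secondDiff; fun_prop
  have hlim : Tendsto (fun b : ℝ => ∫ z, {z : Space d | b < ‖z‖ ∧ ‖z‖ < r}.indicator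
      (secondDiff g x) z ∂ν) (𝓝[>] 0)
      (𝓝 (∫ z, {z : Space d | ‖z‖ < r}.indicator (secondDiff g x) z ∂ν)) := by
    refine tendsto_integral_filter_of_dominated_convergence
      ({z : Space d | ‖z‖ < r}.indicator fun z => C * ‖z‖ ^ 2) ?_ ?_ ?_ ?_
    · exact .of_forall fun b => (hsd.indicator (hms b)).aestronglyMeasurable
    · refine .of_forall fun b => ae_of_all _ fun z => ?_
      by_cases hz : b < ‖z‖ ∧ ‖z‖ < r
      · simpa [indicator, hz] using hC z
      · rw [indicator_of_notMem (by exact hz), norm_zero]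
        exact indicator_nonneg (fun z _ => (abs_nonneg _).trans (hC z)) z
    · exact (integrable_indicator_iff (measurableSet_normBall r)).2
        ((integrableOn_normBall_sq hν r).const_mul C)
    · refine ae_of_all _ fun z => tendsto_const_nhds.congr' ?_
      rcases eq_or_ne z 0 with rfl | hz
      · refine .of_forall fun b => ?_
        have : secondDiff g x 0 = 0 := by unfold secondDiff; simp; ring
        simp [indicator, this]
      · filter_upwards [Ioo_mem_nhdsGT (norm_pos_iff.2 hz)] with b hb
        by_cases hzr : ‖z‖ < r
        · rw [indicator_of_mem (by exact hzr), indicator_of_mem (by exact ⟨hb.2, hzr⟩)]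
        · rw [indicator_of_notMem (by exact hzr), indicator_of_notMem (fun h => hzr h.2)]
  rw [integral_indicator (measurableSet_normBall r)] at hlim
  refine hlim.congr' ?_
  filter_upwards [self_mem_nhdsWithin] with b hb
  rw [integral_indicator (hms b)]
  refine (integral_symm_diff (hms b) (by simp) ?_).2.symm
  refine Measure.integrableOn_of_bounded (M := 2 * M)
    ((measure_mono fun z hz => hz.1).trans_lt (measure_normOuter_lt_top hν hb)).ne
    (by have := hg.measurable; fun_prop) (ae_of_all _ fun z => ?_)
  rw [Real.norm_eq_abs]
  exact (abs_sub _ _).trans (by linarith [hM (x + z), hM x])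

end LevyIntegrals

/-! ### The two parts of the fractional Laplacian as Lévy integrals -/

section Operators

variable {d : ℕ} {c lam : ℝ}

lemma gOuter_eq_levy (hc : 0 < c) (r : ℝ) (g : Space d → ℝ) (x : Space d) :
    gOuter c lam r g x = ∫ z in {z | r < ‖z‖}, (g (x + z) - g x) ∂(levy d c lam) :=
  (setIntegral_levy hc (measurableSet_normOuter r) _).symm

/-- `limUnder` carries information only once convergence is known, which `tendsto_integral_annulus`
supplies. -/
lemma gInner_eq_levy (hd : 0 < d) (hlam : lam ∈ Ioo (0 : ℝ) 2) (hc : 0 < c) (r : ℝ)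
    {g : Space d → ℝ} (hg : Continuous g) {C M : ℝ} (hM : ∀ x, |g x| ≤ M) {x : Space d}
    (hC : ∀ z, |secondDiff g x z| ≤ C * ‖z‖ ^ 2) :
    gInner c lam r g x = ∫ z in {z | ‖z‖ < r}, secondDiff g x z ∂(levy d c lam) := by
  have h := tendsto_integral_annulus (integrable_min_levy hd hlam hc) hg hM hC r
  have hms : ∀ b : ℝ, MeasurableSet {z : Space d | b < ‖z‖ ∧ ‖z‖ < r} := fun b =>
    (measurableSet_normOuter b).inter (measurableSet_normBall r)
  simp only [setIntegral_levy hc (hms _)] at h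
  have h2 := h.const_mul c⁻¹
  simp only [inv_mul_cancel_left₀ hc.ne'] at h2
  rw [gInner, h2.limUnder_eq, mul_inv_cancel_left₀ hc.ne']

end Operators

/-! ### Entropy inequalities on the whole space-time for a Borel representative -/

section Kruzkov

variable {d : ℕ}

/-- The space-time entropy flux `(q_k(u), η_k(u))`. -/
def fluxVec (f : ℝ → Space d) (k u : ℝ) : Space d × ℝ := (flux f k u, eta k u)

/-- The singular part of a symmetric Lévy operator, acting in the space variable. -/
def innerOp (ν : Measure (Space d)) (r : ℝ) (φ : Space d × ℝ → ℝ) (p : Space d × ℝ) : ℝ :=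
  ∫ z in {z : Space d | ‖z‖ < r}, secondDiff φ p (z, 0) ∂ν

/-- The regular part of a Lévy operator, acting in the space variable. -/
def outerOp (ν : Measure (Space d)) (r : ℝ) (w : Space d × ℝ → ℝ) (p : Space d × ℝ) : ℝ :=
  ∫ z in {z : Space d | r < ‖z‖}, (w (p + (z, 0)) - w p) ∂ν

/-- The integrand of the entropy inequality, in terms of the Lévy measure `ν`. -/
def kruzkovIntegrand (ν : Measure (Space d)) (f : ℝ → Space d) (A : ℝ → ℝ)
    (U : Space d × ℝ → ℝ) (k r : ℝ) (φ : Space d × ℝ → ℝ) (p : Space d × ℝ) : ℝ :=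
  fderiv ℝ φ p (fluxVec f k (U p)) + |A (U p) - A k| * innerOp ν r φ p +
    Real.sign (U p - k) * outerOp ν r (fun q => A (U q)) p * φ p

/-- A bounded, integrable, everywhere measurable function satisfying the entropy inequalities
on the whole space-time. -/
structure IsKruzkov (ν : Measure (Space d)) (T : ℝ) (f : ℝ → Space d) (A : ℝ → ℝ)
    (U : Space d × ℝ → ℝ) : Prop where
  measurable : Measurable U
  integrable : Integrable U
  bounded : ∃ M, ∀ p, |U p| ≤ M
  ineq : ∀ k r : ℝ, 0 < r → ∀ φ : Space d × ℝ → ℝ, IsNonnegTest T φ →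
    0 ≤ ∫ p, kruzkovIntegrand ν f A U k r φ p

lemma measurableSet_cylinder (T : ℝ) : MeasurableSet (cylinder d T) :=
  MeasurableSet.univ.prod measurableSet_Ioo

lemma restrict_cylinder (T : ℝ) : (volume : Measure (Space d × ℝ)).restrict (cylinder d T) =
    (volume : Measure (Space d)).prod (volume.restrict (Ioo 0 T)) := by
  rw [cylinder, Measure.volume_eq_prod, ← Measure.prod_restrict, Measure.restrict_univ]

lemma ae_ae_of_ae_cylinder {T : ℝ} {P : Space d × ℝ → Prop}
    (h : ∀ᵐ p ∂(volume.restrict (cylinder d T)), P p) :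
    ∀ᵐ t ∂(volume.restrict (Ioo 0 T)), ∀ᵐ x, P (x, t) := by
  rw [restrict_cylinder] at h
  have := (Measure.measurePreserving_swap (μ := volume.restrict (Ioo 0 T))
    (ν := (volume : Measure (Space d)))).quasiMeasurePreserving.ae h
  exact Measure.ae_ae_of_ae_prod this

lemma ae_cylinder_of_ae {T : ℝ} {P : ℝ → Prop} (h : ∀ᵐ t ∂(volume.restrict (Ioo 0 T)), P t) :
    ∀ᵐ p ∂(volume.restrict (cylinder d T)), P p.2 := by
  rw [restrict_cylinder]
  exact Measure.quasiMeasurePreserving_snd.ae h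

section L1Curve

variable {T : ℝ} {u v : Space d → ℝ → ℝ}

/-- The curve `t ↦ u(·,t)` in `L¹`. -/
def l1Curve (hu : MemCL1 T u) (t : Icc 0 T) : Lp ℝ 1 (volume : Measure (Space d)) :=
  (hu.1 t t.2).toLp _

lemma continuous_l1Curve (hu : MemCL1 T u) : Continuous (l1Curve hu) := by
  rw [continuous_iff_continuousAt]
  intro t
  rw [ContinuousAt, tendsto_iff_edist_tendsto_0]
  have := (hu.2 t t.2).comp (tendsto_nhdsWithin_iff.2
    ⟨continuous_subtype_val.continuousAt.tendsto, .of_forall fun s : Icc 0 T => s.2⟩)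
  refine this.congr fun s => ?_
  rw [l1Curve, l1Curve, Lp.edist_toLp_toLp]
  rfl

lemma norm_l1Curve (hu : MemCL1 T u) (t : Icc 0 T) : ‖l1Curve hu t‖ = ∫ x, ‖u x t‖ := by
  rw [l1Curve, Lp.norm_toLp, eLpNorm_one_eq_lintegral_enorm,
    integral_norm_eq_lintegral_enorm (hu.1 t t.2).1]

lemma norm_l1Curve_sub (hu : MemCL1 T u) (hv : MemCL1 T v) (t : Icc 0 T) :
    ‖l1Curve hu t - l1Curve hv t‖ = (eLpNorm (fun x => u x t - v x t) 1 volume).toReal := by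
  rw [l1Curve, l1Curve, ← MemLp.toLp_sub, Lp.norm_toLp]
  rfl

/-- Compactness of `[0, T]`. The uniform bound makes the solution integrable on the cylinder. -/
lemma exists_integral_norm_le (hu : MemCL1 T u) :
    ∃ B, ∀ t ∈ Icc 0 T, ∫ x, ‖u x t‖ ≤ B := by
  obtain ⟨B, hB⟩ := (isCompact_range (continuous_l1Curve hu).norm).bddAbove
  refine ⟨B, fun t ht => ?_⟩
  rw [← norm_l1Curve hu ⟨t, ht⟩]
  exact hB ⟨_, rfl⟩

end L1Curve

/-- Merges the time derivative and the gradient terms into one derivative along `fluxVec`, so that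
doubling treats space and time alike. -/
lemma fderiv_apply_eq {φ : Space d × ℝ → ℝ} (hφ : Differentiable ℝ φ) (x : Space d) (t : ℝ)
    (w : Space d) (a : ℝ) :
    fderiv ℝ φ (x, t) (w, a) =
      a * deriv (fun s => φ (x, s)) t + inner ℝ w (gradient (fun y => φ (y, t)) x) := by
  have hD := (hφ (x, t)).hasFDerivAt
  have h1 : HasFDerivAt (fun s : ℝ => φ (x, s))
      ((fderiv ℝ φ (x, t)).comp (ContinuousLinearMap.inr ℝ (Space d) ℝ)) t :=
    hD.comp t (hasFDerivAt_prodMk_right x t)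
  have h2 : HasFDerivAt (fun y : Space d => φ (y, t))
      ((fderiv ℝ φ (x, t)).comp (ContinuousLinearMap.inl ℝ (Space d) ℝ)) x :=
    hD.comp x (hasFDerivAt_prodMk_left x t)
  rw [gradient, real_inner_comm, InnerProductSpace.toDual_symm_apply, h2.fderiv,
    h1.hasDerivAt.deriv]
  have : ((w, a) : Space d × ℝ) = a • (0, 1) + (w, 0) := by simp
  rw [this, map_add, map_smul]
  simp

lemma secondDiff_slice (φ : Space d × ℝ → ℝ) (x z : Space d) (t : ℝ) :
    secondDiff (fun y => φ (y, t)) x z = secondDiff φ (x, t) (z, 0) := by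
  simp [secondDiff]

lemma IsNonnegTest.eq_zero_of_notMem {T : ℝ} {φ : Space d × ℝ → ℝ} (hφ : IsNonnegTest T φ)
    {x : Space d} {t : ℝ} (ht : t ∉ Ioo 0 T) : φ (x, t) = 0 :=
  image_eq_zero_of_notMem_tsupport fun h => ht (hφ.support_subset h).2

/-- Jumps take place in space only, so at a time outside `(0, T)` every value of `φ` involved is
zero. Integrals over the cylinder can then be taken over all of space-time. -/
lemma kruzkovIntegrand_eq_zero {T : ℝ} {φ : Space d × ℝ → ℝ} (hφ : IsNonnegTest T φ)
    (ν : Measure (Space d)) (f : ℝ → Space d) (A : ℝ → ℝ) (U : Space d × ℝ → ℝ) (k r : ℝ)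
    {p : Space d × ℝ} (hp : p ∉ cylinder d T) : kruzkovIntegrand ν f A U k r φ p = 0 := by
  obtain ⟨x, t⟩ := p
  have ht : t ∉ Ioo 0 T := fun h => hp ⟨mem_univ _, h⟩
  have h1 : fderiv ℝ φ (x, t) = 0 := by
    by_contra h
    exact hp (hφ.support_subset (support_fderiv_subset ℝ h))
  simp [kruzkovIntegrand, h1, innerOp, secondDiff, hφ.eq_zero_of_notMem ht]

/-- An entropy solution has a representative that is measurable, bounded and integrable on the
whole space-time and satisfies the entropy inequalities there. -/
theorem IsEntropySolution.exists_isKruzkov (hd : 0 < d) {T lam c : ℝ}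
    (hlam : lam ∈ Ioo (0 : ℝ) 2) (hc : 0 < c) {f : ℝ → Space d} {A : ℝ → ℝ}
    {u₀ : Space d → ℝ} {u : Space d → ℝ → ℝ} (hu : IsEntropySolution c lam T f A u₀ u) :
    ∃ U : Space d × ℝ → ℝ, IsKruzkov (levy d c lam) T f A U ∧
      ∀ᵐ p ∂(volume.restrict (cylinder d T)), u p.1 p.2 = U p := by
  set Q := cylinder d T
  have hQm : MeasurableSet Q := measurableSet_cylinder T
  obtain ⟨w, hw, huw⟩ := hu.memLinfty.1
  obtain ⟨M, hM⟩ : ∃ M : ℝ, ∀ᵐ p ∂(volume.restrict Q), ‖u p.1 p.2‖ ≤ M := by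
    have h2 := hu.memLinfty.2
    rw [eLpNorm_exponent_top] at h2
    refine ⟨(eLpNormEssSup (fun p : Space d × ℝ => u p.1 p.2) (volume.restrict Q)).toReal, ?_⟩
    filter_upwards [ae_le_eLpNormEssSup (f := fun p : Space d × ℝ => u p.1 p.2)
      (μ := volume.restrict Q)] with p hp
    rw [← toReal_enorm]
    exact ENNReal.toReal_mono h2.ne hp
  -- Truncation at the essential bound makes the representative bounded everywhere, not just almost
  -- everywhere.
  set U : Space d × ℝ → ℝ := Q.indicator fun p => max (-M) (min M (w p)) with hU
  have hUm : Measurable U :=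
    (measurable_const.max (measurable_const.min hw.measurable)).indicator hQm
  have hUb : ∀ p, |U p| ≤ |M| := by
    intro p
    by_cases hp : p ∈ Q
    · rw [hU, indicator_of_mem hp, abs_le]
      constructor
      · exact (neg_le_neg (le_abs_self M)).trans (le_max_left _ _)
      · exact max_le (neg_le_abs M) ((min_le_left _ _).trans (le_abs_self M))
    · simp [hU, indicator_of_notMem hp]
  have huU : ∀ᵐ p ∂(volume.restrict Q), u p.1 p.2 = U p := by
    filter_upwards [huw, hM, ae_restrict_mem hQm] with p h1 h2 h3
    rw [hU, indicator_of_mem h3, ← h1]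
    rw [Real.norm_eq_abs, abs_le] at h2
    rw [min_eq_right h2.2, max_eq_right h2.1]
  have hslice := ae_ae_of_ae_cylinder huU
  have hU0 : ∀ x t, t ∉ Ioo 0 T → U (x, t) = 0 := fun x t ht =>
    indicator_of_notMem (fun h => ht h.2) _
  have hUi : Integrable U := by
    obtain ⟨B, hB⟩ := exists_integral_norm_le hu.memCL1
    have hslice' := (ae_restrict_iff' measurableSet_Ioo).1 hslice
    rw [Measure.volume_eq_prod, integrable_prod_iff' hUm.aestronglyMeasurable]
    constructor
    · filter_upwards [hslice'] with t ht
      by_cases h : t ∈ Ioo 0 T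
      · exact (memLp_one_iff_integrable.1 (hu.memCL1.1 t (Ioo_subset_Icc_self h))).congr (ht h)
      · simp [hU0 _ t h]
    · have hb : Integrable ((Ioo 0 T).indicator fun _ => B) :=
        (integrable_indicator_iff measurableSet_Ioo).2 (by simp [integrableOn_const_iff])
      refine hb.mono' hUm.norm.stronglyMeasurable.integral_prod_left'.aestronglyMeasurable ?_
      filter_upwards [hslice'] with t ht
      rw [Real.norm_of_nonneg (integral_nonneg fun _ => norm_nonneg _)]
      by_cases h : t ∈ Ioo 0 T
      · rw [indicator_of_mem h]
        refine le_trans (le_of_eq ?_) (hB t (Ioo_subset_Icc_self h))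
        refine integral_congr_ae ?_
        filter_upwards [ht h] with x hx
        rw [hx]
      · simp [hU0 _ t h, indicator_of_notMem h]
  refine ⟨U, ⟨hUm, hUi, ⟨_, hUb⟩, fun k r hr φ hφ => ?_⟩, huU⟩
  refine (hu.entropy_ineq k r hr φ hφ).trans_eq ?_
  rw [← setIntegral_eq_integral_of_forall_compl_eq_zero
    fun p hp => kruzkovIntegrand_eq_zero hφ _ f A U k r hp]
  refine integral_congr_ae ?_
  obtain ⟨C, -, hC⟩ := exists_abs_secondDiff_le hφ.smooth hφ.compact
  obtain ⟨N, hN⟩ := hφ.compact.exists_bound_of_continuous hφ.smooth.continuous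
  filter_upwards [huU, ae_cylinder_of_ae hslice] with p h1 h2
  obtain ⟨x, t⟩ := p
  simp only at h1 h2
  have hin : gInner c lam r (fun y => φ (y, t)) x = innerOp (levy d c lam) r φ (x, t) := by
    have hcont : Continuous fun y => φ (y, t) := by
      have := hφ.smooth.continuous; fun_prop
    rw [gInner_eq_levy hd hlam hc r hcont (fun y => hN (y, t)) (C := C)]
    · simp only [secondDiff_slice, innerOp]
    · intro z
      rw [secondDiff_slice]
      simpa using hC (x, t) (z, 0)
  -- The nonlocal term reads the whole time slice, so equality at the single point is not enough: it
  -- is used that `u = U` almost everywhere on almost every slice, and that the Lévy measure is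
  -- absolutely continuous.
  have hout : gOuter c lam r (fun y => A (u y t)) x =
      outerOp (levy d c lam) r (fun q => A (U q)) (x, t) := by
    rw [gOuter_eq_levy hc, outerOp]
    refine integral_congr_ae (ae_restrict_of_ae ?_)
    refine (withDensity_absolutelyContinuous _ _).ae_le ?_
    have := (quasiMeasurePreserving_add_left (volume : Measure (Space d)) x).ae h2
    filter_upwards [this] with z hz
    simp only [Prod.mk_add_mk, add_zero]
    rw [hz, h1]
  simp only [entropyIntegrand, kruzkovIntegrand, fluxVec]
  rw [fderiv_apply_eq (hφ.smooth.differentiable (by simp)), hin, hout, h1]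
  simp only [eta, eta']

end Kruzkov

/-! ### Integrability of test-function terms -/

section Integrability

variable {E : Type*} [NormedAddCommGroup E] [NormedSpace ℝ E] [FiniteDimensional ℝ E]
  [MeasurableSpace E] [BorelSpace E] {μ : Measure E} [IsFiniteMeasureOnCompacts μ]

lemma integrable_fderiv_apply {Φ : E → ℝ} (hΦ : ContDiff ℝ ∞ Φ) (hc : HasCompactSupport Φ)
    {w : E → E} (hw : Measurable w) {B : ℝ} (hB : ∀ p, ‖w p‖ ≤ B) :
    Integrable (fun p => fderiv ℝ Φ p (w p)) μ := by
  have hcont : Continuous (fderiv ℝ Φ) := hΦ.continuous_fderiv (by simp)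
  have hi : Integrable (fun p => ‖fderiv ℝ Φ p‖ * B) μ :=
    ((hcont.integrable_of_hasCompactSupport (hc.fderiv ℝ)).norm).mul_const B
  refine hi.mono' ?_ (ae_of_all _ fun p => ?_)
  · have hm : StronglyMeasurable fun p => (fderiv ℝ Φ p, w p) :=
      hcont.stronglyMeasurable.prodMk hw.stronglyMeasurable
    exact (isBoundedBilinearMap_apply.continuous.comp_stronglyMeasurable hm).aestronglyMeasurable
  · exact ((fderiv ℝ Φ p).le_opNorm _).trans (by gcongr; exact hB p)

lemma integrable_bounded_mul {E : Type*} [NormedAddCommGroup E] [MeasurableSpace E]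
    [BorelSpace E] {μ : Measure E} [IsFiniteMeasureOnCompacts μ] {Φ : E → ℝ} (hΦ : Continuous Φ) (hc : HasCompactSupport Φ)
    {s : E → ℝ} (hs : Measurable s) {B : ℝ} (hB : ∀ p, |s p| ≤ B) :
    Integrable (fun p => s p * Φ p) μ :=
  (hΦ.integrable_of_hasCompactSupport hc).bdd_mul hs.aestronglyMeasurable (ae_of_all _ hB)

end Integrability

/-! ### Bounds and measurability for the flux and the nonlocal operators -/

section Flux

variable {d : ℕ}

lemma measurable_sign : Measurable Real.sign := by
  unfold Real.sign
  exact Measurable.ite measurableSet_Iio measurable_const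
    (Measurable.ite measurableSet_Ioi measurable_const measurable_const)

lemma abs_sign_le (x : ℝ) : |Real.sign x| ≤ 1 := by
  rcases Real.sign_apply_eq x with h | h | h <;> simp [h]

/-- Symmetry in `u` and `k` lets the two entropy inequalities be added into a single diagonal
derivative. -/
lemma fluxVec_comm (f : ℝ → Space d) (k u : ℝ) : fluxVec f k u = fluxVec f u k := by
  have : Real.sign (k - u) = -Real.sign (u - k) := by rw [← Real.sign_neg, neg_sub]
  simp only [fluxVec, flux, eta, eta', abs_sub_comm u k, this, neg_smul, ← smul_neg, neg_sub]

/-- The bound is linear in `|u - k|`; a mere constant would not stay integrable when the space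
cutoff is removed. -/
lemma norm_fluxVec_le {f : ℝ → Space d} {Lf : ℝ≥0} (hf : LipschitzWith Lf f) (k u : ℝ) :
    ‖fluxVec f k u‖ ≤ (Lf + 1) * |u - k| := by
  have h0 := abs_nonneg (u - k)
  have hL : (0 : ℝ) ≤ Lf := Lf.2
  refine norm_prod_le_iff.2 ⟨?_, ?_⟩
  · have h1 := hf.dist_le_mul u k
    rw [dist_eq_norm, Real.dist_eq] at h1
    simp only [fluxVec, flux, norm_smul, eta', Real.norm_eq_abs]
    calc |Real.sign (u - k)| * ‖f u - f k‖ ≤ 1 * ‖f u - f k‖ := by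
          gcongr; exact abs_sign_le _
      _ ≤ (Lf + 1) * |u - k| := by nlinarith
  · simp only [fluxVec, eta, Real.norm_eq_abs, abs_abs]
    nlinarith

lemma measurable_fluxVec {α : Type*} [MeasurableSpace α] {f : ℝ → Space d} (hf : Continuous f)
    {g h : α → ℝ} (hg : Measurable g) (hh : Measurable h) :
    Measurable fun a => fluxVec f (g a) (h a) := by
  have h1 : Measurable fun a => Real.sign (h a - g a) := measurable_sign.comp (hh.sub hg)
  have h2 : Measurable fun a => f (h a) - f (g a) :=
    (hf.measurable.comp hh).sub (hf.measurable.comp hg)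
  have h3 : Measurable fun a => |h a - g a| := (hh.sub hg).norm
  exact (h1.smul h2).prodMk h3

lemma measurable_outerOp {ν : Measure (Space d)} [SFinite ν] (r : ℝ) {w : Space d × ℝ → ℝ}
    (hw : Measurable w) : Measurable (outerOp ν r w) := by
  have : Measurable fun a : (Space d × ℝ) × Space d => w (a.1 + (a.2, 0)) - w a.1 := by
    fun_prop
  exact this.stronglyMeasurable.integral_prod_right'.measurable

lemma abs_outerOp_le {ν : Measure (Space d)} (hν : Integrable (fun z => min 1 (‖z‖ ^ 2)) ν)
    {r : ℝ} (hr : 0 < r) {w : Space d × ℝ → ℝ} {B : ℝ} (hB : ∀ p, |w p| ≤ B)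
    (p : Space d × ℝ) : |outerOp ν r w p| ≤ 2 * B * ν.real {z | r < ‖z‖} := by
  rw [outerOp, ← Real.norm_eq_abs]
  refine norm_setIntegral_le_of_norm_le_const (measure_normOuter_lt_top hν hr) fun z _ => ?_
  rw [Real.norm_eq_abs]
  exact (abs_sub _ _).trans (by linarith [hB p, hB (p + (z, 0))])

lemma abs_comp_sub_le {A : ℝ → ℝ} {LA : ℝ≥0} (hA : LipschitzWith LA A) (a b : ℝ) : |A a - A b| ≤ LA * |a - b| := by
  simpa [Real.dist_eq] using hA.dist_le_mul a b

lemma abs_sign_mul_outerOp_le {ν : Measure (Space d)}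
    (hν : Integrable (fun z => min 1 (‖z‖ ^ 2)) ν) {A : ℝ → ℝ} {LA : ℝ≥0} {U : Space d × ℝ → ℝ}
    (hA : LipschitzWith LA A) (hA0 : A 0 = 0) {M : ℝ} (hM : ∀ p, |U p| ≤ M) {r : ℝ} (hr : 0 < r)
    (k : ℝ) (p : Space d × ℝ) :
    |Real.sign (U p - k) * outerOp ν r (fun q => A (U q)) p| ≤
      2 * (LA * M) * ν.real {z | r < ‖z‖} := by
  have hb : ∀ p, |A (U p)| ≤ LA * M := fun p => by
    have := abs_comp_sub_le hA (U p) 0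
    rw [hA0, sub_zero, sub_zero] at this
    exact this.trans (by gcongr; exact hM p)
  rw [abs_mul]
  have h1 := abs_outerOp_le hν hr hb p
  calc _ ≤ 1 * |outerOp ν r (fun q => A (U q)) p| := by gcongr; exact abs_sign_le _
    _ ≤ _ := by rw [one_mul]; exact h1

lemma measurable_innerOp {ν : Measure (Space d)} [SFinite ν] (r : ℝ) {φ : Space d × ℝ → ℝ}
    (hφ : Measurable φ) : Measurable (innerOp ν r φ) := by
  have : Measurable fun a : (Space d × ℝ) × Space d => secondDiff φ a.1 (a.2, 0) := by
    unfold secondDiff; fun_prop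
  exact this.stronglyMeasurable.integral_prod_right'.measurable

lemma abs_innerOp_le {ν : Measure (Space d)} (hν : Integrable (fun z => min 1 (‖z‖ ^ 2)) ν)
    {φ : Space d × ℝ → ℝ} {C : ℝ} (r : ℝ) {p : Space d × ℝ}
    (hC : ∀ z, |secondDiff φ p (z, 0)| ≤ C * ‖z‖ ^ 2) :
    |innerOp ν r φ p| ≤ C * ∫ z in {z | ‖z‖ < r}, ‖z‖ ^ 2 ∂ν := by
  rw [← integral_const_mul, innerOp, ← Real.norm_eq_abs]
  exact norm_integral_le_of_norm_le ((integrableOn_normBall_sq hν r).const_mul C)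
    (ae_of_all _ hC)

end Flux

/-! ### Doubling of variables: one entropy inequality, integrated over its level -/

section Doubling

variable {d : ℕ} {ν : Measure (Space d)} [SFinite ν] {T : ℝ} {f : ℝ → Space d} {Lf : ℝ≥0}
  {A : ℝ → ℝ} {LA : ℝ≥0} {U V : Space d × ℝ → ℝ}

lemma fderiv_slice_fst {E F : Type*} [NormedAddCommGroup E] [NormedSpace ℝ E]
    [NormedAddCommGroup F] [NormedSpace ℝ F] {Φ : E × F → ℝ} (hΦ : Differentiable ℝ Φ)
    (p : E) (q : F) (w : E) :
    fderiv ℝ (fun p => Φ (p, q)) p w = fderiv ℝ Φ (p, q) (w, 0) := by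
  have h : HasFDerivAt (fun p => Φ (p, q))
      ((fderiv ℝ Φ (p, q)).comp (ContinuousLinearMap.inl ℝ E F)) p :=
    (hΦ (p, q)).hasFDerivAt.comp p (hasFDerivAt_prodMk_left p q)
  rw [h.fderiv]; simp

lemma hasCompactSupport_slice_fst {X Y : Type*} [TopologicalSpace X] [TopologicalSpace Y]
    [T2Space X] {Φ : X × Y → ℝ} (hΦ : HasCompactSupport Φ) (q : Y) :
    HasCompactSupport fun p => Φ (p, q) := by
  refine HasCompactSupport.intro (hΦ.isCompact.image continuous_fst) fun p hp => ?_
  exact image_eq_zero_of_notMem_tsupport fun h => hp ⟨(p, q), h, rfl⟩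

/-- The integrand obtained from the entropy inequality for `U` with `k = V q`. -/
def doublingIntegrand (ν : Measure (Space d)) (f : ℝ → Space d) (A : ℝ → ℝ)
    (U V : Space d × ℝ → ℝ) (r : ℝ) (Φ : (Space d × ℝ) × (Space d × ℝ) → ℝ)
    (a : (Space d × ℝ) × (Space d × ℝ)) : ℝ :=
  fderiv ℝ Φ a (fluxVec f (V a.2) (U a.1), 0) +
    Real.sign (U a.1 - V a.2) * outerOp ν r (fun q => A (U q)) a.1 * Φ a

lemma norm_fluxVec_le_of_bounded (hf : LipschitzWith Lf f) {M N a b : ℝ} (ha : |a| ≤ M)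
    (hb : |b| ≤ N) : ‖fluxVec f b a‖ ≤ (Lf + 1) * (M + N) :=
  (norm_fluxVec_le hf _ _).trans (by gcongr; exact (abs_sub _ _).trans (by linarith))

lemma integrable_doublingIntegrand (hν : Integrable (fun z => min 1 (‖z‖ ^ 2)) ν)
    (hf : LipschitzWith Lf f) (hA : LipschitzWith LA A) (hA0 : A 0 = 0)
    (hU : Measurable U) (hV : Measurable V) {M N : ℝ} (hM : ∀ p, |U p| ≤ M)
    (hN : ∀ p, |V p| ≤ N) {r : ℝ} (hr : 0 < r) {Φ : (Space d × ℝ) × (Space d × ℝ) → ℝ}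
    (hΦ : ContDiff ℝ ∞ Φ) (hΦc : HasCompactSupport Φ) :
    Integrable (doublingIntegrand ν f A U V r Φ) := by
  refine (integrable_fderiv_apply hΦ hΦc
    ((measurable_fluxVec hf.continuous (hV.comp measurable_snd)
      (hU.comp measurable_fst)).prodMk measurable_const) (B := (Lf + 1) * (M + N))
      fun a => ?_).add
    (integrable_bounded_mul hΦ.continuous hΦc ((measurable_sign.comp
      ((hU.comp measurable_fst).sub (hV.comp measurable_snd))).mul
      ((measurable_outerOp r (hA.continuous.measurable.comp hU)).comp measurable_fst))
      fun a => abs_sign_mul_outerOp_le hν hA hA0 hM hr _ _)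
  rw [Prod.norm_mk, norm_zero, max_eq_left (norm_nonneg _)]
  exact norm_fluxVec_le_of_bounded hf (hM _) (hN _)

/-- Integrating the entropy inequality for `U` with `k = V q` over `q`: the contribution of the
singular part of the operator vanishes with the truncation radius. -/
theorem IsKruzkov.exists_integral_doublingIntegrand_ge
    (hν : Integrable (fun z => min 1 (‖z‖ ^ 2)) ν)
    (hf : LipschitzWith Lf f) (hA : LipschitzWith LA A) (hA0 : A 0 = 0)
    (hU : IsKruzkov ν T f A U) (hV : Measurable V) {N : ℝ} (hN : ∀ p, |V p| ≤ N)
    {Φ : (Space d × ℝ) × (Space d × ℝ) → ℝ} (hΦ : ContDiff ℝ ∞ Φ) (hΦc : HasCompactSupport Φ)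
    (hΦ0 : ∀ a, 0 ≤ Φ a) (hΦs : ∀ q, tsupport (fun p => Φ (p, q)) ⊆ cylinder d T) :
    ∃ e : ℝ → ℝ, Tendsto e (𝓝[>] 0) (𝓝 0) ∧ ∀ r ∈ Ioo (0 : ℝ) 1,
      0 ≤ (∫ a, doublingIntegrand ν f A U V r Φ a) + e r := by
  obtain ⟨M, hM⟩ := hU.bounded
  obtain ⟨C, hC0, hC⟩ := exists_abs_secondDiff_le hΦ hΦc
  -- For `r < 1`, jumps shorter than `r` from outside this compact set never reach the support of
  -- `Φ`, so the singular part is supported in `K`.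
  set K := Metric.cthickening 1 (tsupport Φ)
  have hKc : IsCompact K := hΦc.isCompact.cthickening
  have hM0 : 0 ≤ M := (abs_nonneg _).trans (hM 0)
  have hN0 : 0 ≤ N := (abs_nonneg _).trans (hN 0)
  set a : ℝ → ℝ := fun r => ∫ z in {z : Space d | ‖z‖ < r}, ‖z‖ ^ 2 ∂ν
  have ha0 : ∀ r, 0 ≤ a r := fun r => integral_nonneg fun _ => by positivity
  set b : ℝ → ℝ := fun r => LA * (M + N) * (C * a r) with hb
  refine ⟨fun r => b r * volume.real K, ?_, fun r hr => ?_⟩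
  · have h := ((tendsto_setIntegral_normBall_sq hν).const_mul C).const_mul (LA * (M + N))
    simpa using h.mul_const (volume.real K)
  have hKi : Integrable (K.indicator fun _ => b r) :=
    (integrable_indicator_iff hKc.measurableSet).2
      (integrableOn_const hKc.measure_lt_top.ne)
  have hDi := integrable_doublingIntegrand hν hf hA hA0 hU.measurable hV hM hN hr.1 hΦ hΦc
  have hKint : ∫ x, K.indicator (fun _ => b r) x = b r * volume.real K := by
    rw [integral_indicator hKc.measurableSet, setIntegral_const, smul_eq_mul, mul_comm]
  change 0 ≤ _ + b r * volume.real K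
  -- The error is written as an integral over `K`, so that after Fubini nonnegativity can be checked
  -- for each fixed `q`.
  rw [← hKint, ← integral_add hDi hKi, Measure.volume_eq_prod, integral_prod_symm _
    (by rw [← Measure.volume_eq_prod]; exact hDi.add hKi)]
  refine integral_nonneg fun q => ?_
  have htest : IsNonnegTest T fun p => Φ (p, q) :=
    ⟨hΦ.comp (contDiff_id.prodMk contDiff_const), hasCompactSupport_slice_fst hΦc q, hΦs q,
      fun p => hΦ0 _⟩
  have hinner : ∀ p, |innerOp ν r (fun p => Φ (p, q)) p| ≤ K.indicator (fun _ => C * a r) (p, q) := by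
    intro p
    by_cases hp : (p, q) ∈ K
    · rw [indicator_of_mem hp]
      refine abs_innerOp_le hν r fun z => ?_
      have := hC (p, q) ((z, 0), 0)
      simpa [secondDiff] using this
    · rw [indicator_of_notMem hp, innerOp, setIntegral_eq_zero_of_forall_eq_zero, abs_zero]
      intro z hz
      have hzero : ∀ h : Space d, ‖h‖ ≤ 1 → Φ (p + (h, 0), q) = 0 := by
        intro h hh
        refine image_eq_zero_of_notMem_tsupport fun hmem => hp ?_
        refine Metric.mem_cthickening_of_dist_le _ _ 1 _ hmem ?_
        simpa [dist_eq_norm, Prod.norm_def] using hh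
      have hz1 : ‖z‖ ≤ 1 := (le_of_lt hz).trans hr.2.le
      have h1 := hzero z hz1
      have h2 := hzero (-z) (by simpa using hz1)
      have h3 := hzero 0 (by simp)
      have h4 : p - (z, 0) = p + (-z, 0) := by ext <;> simp [sub_eq_add_neg]
      have h5 : p + ((0 : Space d), (0 : ℝ)) = p := by ext <;> simp
      rw [h5] at h3
      simp [secondDiff, h4, h1, h2, h3]
  have hAb : ∀ p, |A (U p) - A (V q)| ≤ LA * (M + N) := fun p =>
    (abs_comp_sub_le hA _ _).trans (by
      gcongr; exact (abs_sub _ _).trans (by linarith [hM p, hN q]))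
  have hsl : IsCompact ((fun p => (p, q)) ⁻¹' K) := by
    refine (hKc.image continuous_fst).of_isClosed_subset
      (hKc.isClosed.preimage (by fun_prop)) fun p hp => ⟨(p, q), hp, rfl⟩
  have hsi : Integrable fun p => K.indicator (fun _ => b r) (p, q) := by
    have : (fun p => K.indicator (fun _ => b r) (p, q)) =
        ((fun p => (p, q)) ⁻¹' K).indicator fun _ => b r := by
      rfl
    rw [this]
    exact (integrable_indicator_iff hsl.measurableSet).2
      (integrableOn_const hsl.measure_lt_top.ne)
  have hT3 : ∀ p, |A (U p) - A (V q)| * |innerOp ν r (fun p => Φ (p, q)) p| ≤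
      K.indicator (fun _ => b r) (p, q) := by
    intro p
    refine (mul_le_mul (hAb p) (hinner p) (abs_nonneg _) (by positivity)).trans_eq ?_
    by_cases hp : (p, q) ∈ K <;> simp [hp, hb]
  have hT3i : Integrable fun p => |A (U p) - A (V q)| * innerOp ν r (fun p => Φ (p, q)) p := by
    refine hsi.mono' ?_ (ae_of_all _ fun p => ?_)
    · exact (((hA.continuous.measurable.comp hU.measurable).sub_const _).norm.mul
        (measurable_innerOp r htest.smooth.continuous.measurable)).aestronglyMeasurable
    · rw [Real.norm_eq_abs, abs_mul, abs_abs]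
      exact hT3 p
  have hDs : Integrable fun p => doublingIntegrand ν f A U V r Φ (p, q) := by
    have h1 := integrable_fderiv_apply (μ := volume) htest.smooth htest.compact
      (measurable_fluxVec hf.continuous (measurable_const (a := V q)) hU.measurable)
      fun p => norm_fluxVec_le_of_bounded hf (hM p) (hN q)
    have h2 := integrable_bounded_mul (μ := volume) htest.smooth.continuous htest.compact
      ((measurable_sign.comp (hU.measurable.sub_const (V q))).mul
        (measurable_outerOp (ν := ν) r (hA.continuous.measurable.comp hU.measurable)))
      fun p => abs_sign_mul_outerOp_le hν hA hA0 hM hr.1 _ _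
    refine (h1.add h2).congr (ae_of_all _ fun p => ?_)
    simp only [doublingIntegrand, Pi.add_apply, Pi.mul_apply, Function.comp_def,
      fderiv_slice_fst (hΦ.differentiable (by simp))]
  have hkr : ∀ p, kruzkovIntegrand ν f A U (V q) r (fun p => Φ (p, q)) p =
      doublingIntegrand ν f A U V r Φ (p, q) +
        |A (U p) - A (V q)| * innerOp ν r (fun p => Φ (p, q)) p := by
    intro p
    simp only [kruzkovIntegrand, doublingIntegrand,
      fderiv_slice_fst (hΦ.differentiable (by simp))]
    ring
  refine (hU.ineq (V q) r hr.1 _ htest).trans ?_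
  simp only [hkr]
  refine integral_mono (hDs.add hT3i) (hDs.add hsi) fun p => ?_
  simp only
  gcongr
  exact (mul_le_mul_of_nonneg_left (le_abs_self _) (abs_nonneg _)).trans (hT3 p)

end Doubling

instance isAddHaarMeasure_spaceTime (d : ℕ) :
    (volume : Measure (Space d × ℝ)).IsAddHaarMeasure := by
  rw [Measure.volume_eq_prod]; infer_instance

instance isAddHaarMeasure_doubled (d : ℕ) :
    (volume : Measure ((Space d × ℝ) × (Space d × ℝ))).IsAddHaarMeasure :=
  Measure.prod.instIsAddHaarMeasure _ _

/-! ### Transposition of jump operators of finite intensity -/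

section Transpose

variable {G S : Type*} [AddGroup G] [MeasurableSpace G] [MeasurableAdd₂ G] [MeasurableNeg G]
  [MeasurableSpace S]

/-- Transposition of a finite jump operator. -/
lemma integral_jump_mul {μ : Measure G} [SFinite μ] [μ.IsAddRightInvariant] {m : Measure S}
    [IsFiniteMeasure m] {τ : S → G} (hτ : Measurable τ) {D Φ : G → ℝ} (hD : Measurable D)
    {B : ℝ} (hB : ∀ x, |D x| ≤ B) (hΦm : Measurable Φ) (hΦ : Integrable Φ μ) :
    ∫ x, (∫ z, (D (x + τ z) - D x) ∂m) * Φ x ∂μ = ∫ x, D x * (∫ z, (Φ (x - τ z) - Φ x) ∂m) ∂μ := by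
  have hΦ1 : Integrable (fun a : G × S => Φ a.1) (μ.prod m) := hΦ.comp_fst m
  have h1 : Integrable (fun a : G × S => D (a.1 + τ a.2) * Φ a.1) (μ.prod m) :=
    hΦ1.bdd_mul (c := B) (by fun_prop : Measurable fun a : G × S => D (a.1 + τ a.2)).aestronglyMeasurable
      (ae_of_all _ fun a => hB _)
  have h2 : Integrable (fun a : G × S => D a.1 * Φ a.1) (μ.prod m) :=
    hΦ1.bdd_mul (c := B) (hD.comp measurable_fst).aestronglyMeasurable
      (ae_of_all _ fun a => hB _)
  have hs : ∀ z, Integrable (fun x => Φ (x - τ z)) μ := fun z => hΦ.comp_sub_right _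
  have hsub : Measurable fun a : G × S => Φ (a.1 - τ a.2) := by
    simp only [sub_eq_add_neg]; fun_prop
  have h3' : Integrable (fun a : G × S => Φ (a.1 - τ a.2)) (μ.prod m) := by
    rw [integrable_prod_iff' hsub.aestronglyMeasurable]
    refine ⟨ae_of_all _ fun z => hs z, ?_⟩
    simp only [integral_sub_right_eq_self (fun x => ‖Φ x‖)]
    exact integrable_const _
  have h3 : Integrable (fun a : G × S => D a.1 * Φ (a.1 - τ a.2)) (μ.prod m) :=
    h3'.bdd_mul (c := B) (hD.comp measurable_fst).aestronglyMeasurable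
      (ae_of_all _ fun a => hB _)
  have e1 : ∫ x, (∫ z, (D (x + τ z) - D x) ∂m) * Φ x ∂μ =
      ∫ a, (D (a.1 + τ a.2) * Φ a.1 - D a.1 * Φ a.1) ∂(μ.prod m) := by
    refine Eq.trans ?_ (integral_prod _ (h1.sub h2)).symm
    simp only [Pi.sub_apply, ← integral_mul_const, sub_mul]
  have e2 : ∫ x, D x * (∫ z, (Φ (x - τ z) - Φ x) ∂m) ∂μ =
      ∫ a, (D a.1 * Φ (a.1 - τ a.2) - D a.1 * Φ a.1) ∂(μ.prod m) := by
    refine Eq.trans ?_ (integral_prod _ (h3.sub h2)).symm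
    simp only [Pi.sub_apply, ← integral_const_mul, mul_sub]
  rw [e1, e2, integral_sub h1 h2, integral_sub h3 h2, integral_prod_symm _ h1,
    integral_prod_symm _ h3]
  congr 2
  ext z
  -- For each jump `z`, translation invariance moves the shift from `D` to `Φ` with the opposite
  -- sign. Finiteness of `m` justified separating the two terms and exchanging the integrals.
  have := integral_add_right_eq_self (μ := μ) (fun x => D x * Φ (x - τ z)) (τ z)
  simpa using this

end Transpose

/-! ### Doubling of variables: adding the two inequalities -/

section Doubling

variable {d : ℕ} {ν : Measure (Space d)} [SFinite ν] {T : ℝ} {f : ℝ → Space d} {Lf : ℝ≥0}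
  {A : ℝ → ℝ} {LA : ℝ≥0} {U V : Space d × ℝ → ℝ}

/-- Convexity of `|A(u) - A(v)|` along jumps. -/
lemma sign_mul_jump_le (hAmono : Monotone A) (u v u' v' : ℝ) :
    Real.sign (u - v) * ((A u' - A u) - (A v' - A v)) ≤ |A u' - A v'| - |A u - A v| := by
  -- Monotonicity makes `A u - A v` share the weak sign of `u - v`, so intervals where `A` is
  -- constant do no harm. When `u = v`, the convention `sgn 0 = 0` kills the left side.
  rcases lt_trichotomy u v with h | h | h
  · have h1 := hAmono h.le
    rw [Real.sign_of_neg (by linarith), abs_of_nonpos (by linarith : A u - A v ≤ 0)]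
    linarith [neg_le_abs (A u' - A v')]
  · subst h; simp
  · have h1 := hAmono h.le
    rw [Real.sign_of_pos (by linarith), abs_of_nonneg (by linarith : 0 ≤ A u - A v)]
    linarith [le_abs_self (A u' - A v')]

/-- The doubling of variables inequality. -/
theorem IsKruzkov.doubling (hν : Integrable (fun z => min 1 (‖z‖ ^ 2)) ν)
    (hf : LipschitzWith Lf f) (hA : LipschitzWith LA A) (hAmono : Monotone A) (hA0 : A 0 = 0)
    (hU : IsKruzkov ν T f A U) (hV : IsKruzkov ν T f A V)
    {Φ : (Space d × ℝ) × (Space d × ℝ) → ℝ} (hΦ : ContDiff ℝ ∞ Φ) (hΦc : HasCompactSupport Φ)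
    (hΦ0 : ∀ a, 0 ≤ Φ a) (hΦ1 : ∀ q, tsupport (fun p => Φ (p, q)) ⊆ cylinder d T)
    (hΦ2 : ∀ p, tsupport (fun q => Φ (p, q)) ⊆ cylinder d T) :
    ∃ e : ℝ → ℝ, Tendsto e (𝓝[>] 0) (𝓝 0) ∧ ∀ r ∈ Ioo (0 : ℝ) 1,
      0 ≤ (∫ a : (Space d × ℝ) × (Space d × ℝ),
          fderiv ℝ Φ a (fluxVec f (V a.2) (U a.1), fluxVec f (V a.2) (U a.1))) +
        (∫ a : (Space d × ℝ) × (Space d × ℝ), |A (U a.1) - A (V a.2)| *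
          ∫ z in {z : Space d | r < ‖z‖}, (Φ (a - ((z, 0), (z, 0))) - Φ a) ∂ν) + e r := by
  obtain ⟨M, hM⟩ := hU.bounded
  obtain ⟨N, hN⟩ := hV.bounded
  have hΦd : Differentiable ℝ Φ := hΦ.differentiable (by simp)
  have hΨ : ContDiff ℝ ∞ (fun b : (Space d × ℝ) × (Space d × ℝ) => Φ b.swap) :=
    hΦ.comp (contDiff_snd.prodMk contDiff_fst)
  have hΨc : HasCompactSupport fun b : (Space d × ℝ) × (Space d × ℝ) => Φ b.swap :=
    hΦc.comp_homeomorph (Homeomorph.prodComm _ _)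
  obtain ⟨e₁, he₁, h₁⟩ := hU.exists_integral_doublingIntegrand_ge hν hf hA hA0 hV.measurable hN
    hΦ hΦc hΦ0 hΦ1
  obtain ⟨e₂, he₂, h₂⟩ := hV.exists_integral_doublingIntegrand_ge hν hf hA hA0 hU.measurable hM
    hΨ hΨc (fun _ => hΦ0 _) hΦ2
  refine ⟨fun r => e₁ r + e₂ r, by simpa using he₁.add he₂, fun r hr => ?_⟩
  have hfin : IsFiniteMeasure (ν.restrict {z : Space d | r < ‖z‖}) :=
    ⟨by simpa using measure_normOuter_lt_top hν hr.1⟩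
  have i₁ := integrable_doublingIntegrand hν hf hA hA0 hU.measurable hV.measurable hM hN hr.1
    hΦ hΦc
  have i₂ : Integrable fun a : (Space d × ℝ) × (Space d × ℝ) => doublingIntegrand ν f A V U r
      (fun b : (Space d × ℝ) × (Space d × ℝ) => Φ b.swap) a.swap :=
    (integrable_doublingIntegrand hν hf hA hA0 hV.measurable hU.measurable hN hM hr.1
    hΨ hΨc).swap
  have hAU : Measurable fun p => A (U p) := hA.continuous.measurable.comp hU.measurable
  have hAV : Measurable fun p => A (V p) := hA.continuous.measurable.comp hV.measurable
  set D : (Space d × ℝ) × (Space d × ℝ) → ℝ := fun a => |A (U a.1) - A (V a.2)| with hD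
  have hDm : Measurable D := ((hAU.comp measurable_fst).sub (hAV.comp measurable_snd)).norm
  have hDb : ∀ a, |D a| ≤ LA * (M + N) := fun a => by
    rw [hD, abs_abs]
    exact (abs_comp_sub_le hA _ _).trans (by
      gcongr; exact (abs_sub _ _).trans (by linarith [hM a.1, hN a.2]))
  have hτ : Measurable fun z : Space d => (((z, 0), (z, 0)) : (Space d × ℝ) × (Space d × ℝ)) := by
    fun_prop
  have hfd : Integrable fun a : (Space d × ℝ) × (Space d × ℝ) =>
      fderiv ℝ Φ a (fluxVec f (V a.2) (U a.1), fluxVec f (V a.2) (U a.1)) := by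
    have hm := measurable_fluxVec hf.continuous (hV.measurable.comp measurable_snd)
      (hU.measurable.comp (measurable_fst (α := Space d × ℝ) (β := Space d × ℝ)))
    refine integrable_fderiv_apply hΦ hΦc (hm.prodMk hm) (B := (Lf + 1) * (M + N)) fun a => ?_
    simp only [Prod.norm_mk, max_self]
    exact norm_fluxVec_le_of_bounded hf (hM _) (hN _)
  have hjump : Integrable fun a : (Space d × ℝ) × (Space d × ℝ) =>
      (∫ z in {z : Space d | r < ‖z‖}, (D (a + ((z, 0), (z, 0))) - D a) ∂ν) * Φ a := by
    refine integrable_bounded_mul hΦ.continuous hΦc ?_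
      (B := 2 * (LA * (M + N)) * ν.real {z | r < ‖z‖}) fun a => ?_
    · have : Measurable fun b : ((Space d × ℝ) × (Space d × ℝ)) × Space d =>
          D (b.1 + ((b.2, 0), (b.2, 0))) - D b.1 := by fun_prop
      exact this.stronglyMeasurable.integral_prod_right'.measurable
    · rw [← Real.norm_eq_abs]
      refine norm_setIntegral_le_of_norm_le_const (measure_normOuter_lt_top hν hr.1) fun z _ => ?_
      rw [Real.norm_eq_abs]
      exact (abs_sub _ _).trans (by linarith [hDb a, hDb (a + ((z, 0), (z, 0)))])
  have hswap : ∫ b, doublingIntegrand ν f A V U r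
        (fun b : (Space d × ℝ) × (Space d × ℝ) => Φ b.swap) b =
      ∫ a : (Space d × ℝ) × (Space d × ℝ), doublingIntegrand ν f A V U r
        (fun b : (Space d × ℝ) × (Space d × ℝ) => Φ b.swap) a.swap := by
    rw [Measure.volume_eq_prod]
    exact (integral_prod_swap _).symm
  have hsum : (∫ a, doublingIntegrand ν f A U V r Φ a) + (∫ b, doublingIntegrand ν f A V U r
        (fun b : (Space d × ℝ) × (Space d × ℝ) => Φ b.swap) b) ≤
      (∫ a : (Space d × ℝ) × (Space d × ℝ),
          fderiv ℝ Φ a (fluxVec f (V a.2) (U a.1), fluxVec f (V a.2) (U a.1))) +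
        (∫ a : (Space d × ℝ) × (Space d × ℝ), D a *
          ∫ z in {z : Space d | r < ‖z‖}, (Φ (a - ((z, 0), (z, 0))) - Φ a) ∂ν) := by
    -- Putting the diagonal jump back on `D` reduces the comparison to a pointwise one in `(p, q)`.
    rw [hswap, ← integral_add i₁ i₂, ← integral_jump_mul hτ hDm hDb hΦ.continuous.measurable
      (hΦ.continuous.integrable_of_hasCompactSupport hΦc), ← integral_add hfd hjump]
    refine integral_mono (i₁.add i₂) (hfd.add hjump) fun a => ?_
    obtain ⟨p, q⟩ := a
    have hfs : fderiv ℝ (fun b : (Space d × ℝ) × (Space d × ℝ) => Φ b.swap) (q, p)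
        (fluxVec f (U p) (V q), 0) = fderiv ℝ Φ (p, q) (0, fluxVec f (V q) (U p)) := by
      have h : HasFDerivAt (fun b : (Space d × ℝ) × (Space d × ℝ) => Φ b.swap)
          ((fderiv ℝ Φ (p, q)).comp ((ContinuousLinearMap.snd ℝ (Space d × ℝ) (Space d × ℝ)).prod
            (ContinuousLinearMap.fst ℝ (Space d × ℝ) (Space d × ℝ)))) (q, p) :=
        HasFDerivAt.comp (g := Φ) (q, p) (hΦd (p, q)).hasFDerivAt
          (hasFDerivAt_snd.prodMk hasFDerivAt_fst)
      rw [h.fderiv, fluxVec_comm f (U p)]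
      simp
    have hsplit : fderiv ℝ Φ (p, q) (fluxVec f (V q) (U p), fluxVec f (V q) (U p)) =
        fderiv ℝ Φ (p, q) (fluxVec f (V q) (U p), 0) +
          fderiv ℝ Φ (p, q) (0, fluxVec f (V q) (U p)) := by
      rw [← map_add]; simp
    have hsgn : Real.sign (V q - U p) = -Real.sign (U p - V q) := by
      rw [← Real.sign_neg, neg_sub]
    have hb : ∀ w : Space d × ℝ → ℝ, Measurable w → (∃ B, ∀ p, |w p| ≤ B) → ∀ p,
        Integrable (fun z : Space d => w (p + (z, 0)) - w p)
          (ν.restrict {z : Space d | r < ‖z‖}) := by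
      rintro w hw ⟨B, hB⟩ p
      refine Integrable.of_bound (C := B + B) (Measurable.aestronglyMeasurable (by fun_prop))
        (ae_of_all _ fun z => ?_)
      rw [Real.norm_eq_abs]
      exact (abs_sub _ _).trans (add_le_add (hB _) (hB _))
    have hbA : ∀ {W : Space d × ℝ → ℝ} {K : ℝ}, (∀ p, |W p| ≤ K) → ∃ B, ∀ p, |A (W p)| ≤ B := by
      intro W K hW
      refine ⟨LA * K, fun p => ?_⟩
      have := abs_comp_sub_le hA (W p) 0
      rw [hA0, sub_zero, sub_zero] at this
      exact this.trans (by gcongr; exact hW p)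
    have jU := hb _ hAU (hbA hM) p
    have jV := hb _ hAV (hbA hN) q
    have jD : Integrable (fun z : Space d => D ((p, q) + ((z, 0), (z, 0))) - D (p, q))
        (ν.restrict {z : Space d | r < ‖z‖}) := by
      refine Integrable.of_bound (C := LA * (M + N) + LA * (M + N))
        (Measurable.aestronglyMeasurable (by fun_prop))
        (ae_of_all _ fun z => ?_)
      rw [Real.norm_eq_abs]
      exact (abs_sub _ _).trans (add_le_add (hDb _) (hDb _))
    have hnl : Real.sign (U p - V q) *
        (outerOp ν r (fun q => A (U q)) p - outerOp ν r (fun q => A (V q)) q) ≤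
        ∫ z in {z : Space d | r < ‖z‖}, (D ((p, q) + ((z, 0), (z, 0))) - D (p, q)) ∂ν := by
      rw [outerOp, outerOp, ← integral_sub jU jV, ← integral_const_mul]
      refine integral_mono ((jU.sub jV).const_mul _) jD fun z => ?_
      exact sign_mul_jump_le hAmono (U p) (V q) (U (p + (z, 0))) (V (q + (z, 0)))
    have := mul_le_mul_of_nonneg_right hnl (hΦ0 (p, q))
    simp only [doublingIntegrand, Prod.swap_prod_mk]
    rw [hfs, hsplit, hsgn]
    linarith
  have := h₁ r hr
  have := h₂ r hr
  simp only
  linarith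

end Doubling

/-! ### The test function `ρ(p - q) ψ(p)` -/

section Mollified

variable {d : ℕ} {T : ℝ} {f : ℝ → Space d} {Lf : ℝ≥0}
  {A : ℝ → ℝ} {LA : ℝ≥0} {U V ρ ψ : Space d × ℝ → ℝ}

lemma integrable_snd_mul_mollifier (hV : Integrable V) (hρ : Integrable ρ) :
    Integrable fun a : (Space d × ℝ) × (Space d × ℝ) => V a.2 * ρ (a.1 - a.2) :=
  hV.convolution_integrand (ContinuousLinearMap.mul ℝ ℝ) hρ

lemma integrable_fst_mul_mollifier (hU : Integrable U) (hρ : Integrable ρ) :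
    Integrable fun a : (Space d × ℝ) × (Space d × ℝ) => U a.1 * ρ (a.1 - a.2) := by
  have := (integrable_snd_mul_mollifier hU hρ.comp_neg).swap
  refine this.congr (ae_of_all _ fun a => ?_)
  simp

/-- Although `ρ(p - q)` is not compactly supported on the doubled space, its products with `U p` and
`V q` are convolution integrands of `L¹` functions. This majorant makes it possible to remove the
space cutoff with `ρ` fixed. -/
lemma integrable_abs_sub_mul_mollifier (hU : Integrable U) (hV : Integrable V) (hUm : Measurable U)
    (hVm : Measurable V) (hρ : Integrable ρ) (hρm : Measurable ρ) :
    Integrable fun a : (Space d × ℝ) × (Space d × ℝ) => |U a.1 - V a.2| * ρ (a.1 - a.2) := by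
  refine ((integrable_fst_mul_mollifier hU hρ).norm.add
    (integrable_snd_mul_mollifier hV hρ).norm).mono' (by fun_prop) (ae_of_all _ fun a => ?_)
  simp only [Pi.add_apply, norm_mul, Real.norm_eq_abs, abs_abs, ← add_mul]
  gcongr
  exact abs_sub _ _

/-- A diagonal direction does not change `p - q`, so the derivative of `ρ` drops out. -/
lemma fderiv_mollified (hρ : Differentiable ℝ ρ) (hψ : Differentiable ℝ ψ)
    (a : (Space d × ℝ) × (Space d × ℝ)) (w : Space d × ℝ) :
    fderiv ℝ (fun a : (Space d × ℝ) × (Space d × ℝ) => ρ (a.1 - a.2) * ψ a.1) a (w, w) =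
      ρ (a.1 - a.2) * fderiv ℝ ψ a.1 w := by
  have h1 : HasFDerivAt (fun a : (Space d × ℝ) × (Space d × ℝ) => ρ (a.1 - a.2))
      ((fderiv ℝ ρ (a.1 - a.2)).comp (ContinuousLinearMap.fst ℝ _ _ -
        ContinuousLinearMap.snd ℝ _ _)) a :=
    HasFDerivAt.comp (g := ρ) a (hρ _).hasFDerivAt (hasFDerivAt_fst.sub hasFDerivAt_snd)
  have h2 : HasFDerivAt (fun a : (Space d × ℝ) × (Space d × ℝ) => ψ a.1)
      ((fderiv ℝ ψ a.1).comp (ContinuousLinearMap.fst ℝ _ _)) a :=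
    HasFDerivAt.comp (g := ψ) a (hψ _).hasFDerivAt hasFDerivAt_fst
  have h3 : fderiv ℝ (fun a : (Space d × ℝ) × (Space d × ℝ) => ρ (a.1 - a.2) * ψ a.1) a = _ :=
    (h1.mul h2).fderiv
  rw [h3]
  simp

/-- Symmetrisation turns the truncated integral into one of second differences, giving a bound
independent of `r`. The reflection `y ↦ ψ (-y, t)` converts jumps by `-z` into the form required by
`integral_symm_diff`. -/
lemma abs_integral_outer_le {ν : Measure (Space d)} [ν.IsNegInvariant]
    (hν : Integrable (fun z => min 1 (‖z‖ ^ 2)) ν) (hψ : Continuous ψ) {B : ℝ}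
    (hB : ∀ p, |ψ p| ≤ B) {k : Space d → ℝ} (hk : Integrable k ν)
    (hψk : ∀ p z, |secondDiff ψ p (z, 0)| ≤ k z) {r : ℝ} (hr : 0 < r) (p : Space d × ℝ) :
    |∫ z in {z : Space d | r < ‖z‖}, (ψ (p - (z, 0)) - ψ p) ∂ν| ≤ ∫ z, k z ∂ν := by
  obtain ⟨x, t⟩ := p
  have hk0 : ∀ z, 0 ≤ k z := fun z => (abs_nonneg _).trans (hψk 0 z)
  have hint : IntegrableOn (fun z => ψ (-(-x + z), t) - ψ (-(-x), t)) {z : Space d | r < ‖z‖} ν := by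
    refine Measure.integrableOn_of_bounded (M := B + B) (measure_normOuter_lt_top hν hr).ne
      (Continuous.aestronglyMeasurable (by fun_prop)) (ae_of_all _ fun z => ?_)
    rw [Real.norm_eq_abs]
    exact (abs_sub _ _).trans (add_le_add (hB _) (hB _))
  have hsymm := (integral_symm_diff (measurableSet_normOuter r) (by simp)
    (g := fun y => ψ (-y, t)) (x := -x) hint).2
  have hL : ∀ z, ψ ((x, t) - (z, 0)) - ψ (x, t) = ψ (-(-x + z), t) - ψ (-(-x), t) := by
    intro z
    simp [sub_eq_add_neg, add_comm]
  simp only [hL]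
  rw [hsymm, ← Real.norm_eq_abs]
  refine (norm_integral_le_of_norm_le hk.integrableOn (ae_of_all _ fun z => ?_)).trans
    (setIntegral_le_integral hk (ae_of_all _ hk0))
  refine le_trans (le_of_eq ?_) (hψk (x, t) z)
  rw [Real.norm_eq_abs]
  congr 1
  have e1 : -(-x + z) = x - z := by abel
  have e2 : -(-x - z) = x + z := by abel
  simp only [secondDiff, Prod.mk_add_mk, Prod.mk_sub_mk, add_zero, sub_zero, e1, e2, neg_neg]
  ring

/-- The doubling of variables inequality for the test function `ρ(p - q) ψ(p)`, where `k`
dominates the second differences of `ψ`. -/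
theorem IsKruzkov.mollified {ν : Measure (Space d)} [SFinite ν] [ν.IsNegInvariant]
    (hν : Integrable (fun z => min 1 (‖z‖ ^ 2)) ν)
    (hf : LipschitzWith Lf f) (hA : LipschitzWith LA A) (hAmono : Monotone A) (hA0 : A 0 = 0)
    (hU : IsKruzkov ν T f A U) (hV : IsKruzkov ν T f A V)
    (hρ : ContDiff ℝ ∞ ρ) (hρc : HasCompactSupport ρ) (hρ0 : ∀ p, 0 ≤ ρ p)
    (hψ : IsNonnegTest T ψ)
    (hsupp : ∀ p ∈ tsupport ψ, ∀ h ∈ tsupport ρ, p - h ∈ cylinder d T)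
    {k : Space d → ℝ} (hk : Integrable k ν) (hψk : ∀ p z, |secondDiff ψ p (z, 0)| ≤ k z) :
    0 ≤ (∫ a : (Space d × ℝ) × (Space d × ℝ),
        ρ (a.1 - a.2) * fderiv ℝ ψ a.1 (fluxVec f (V a.2) (U a.1))) +
      (∫ z, k z ∂ν) * ∫ a : (Space d × ℝ) × (Space d × ℝ),
        |A (U a.1) - A (V a.2)| * ρ (a.1 - a.2) := by
  set Φ : (Space d × ℝ) × (Space d × ℝ) → ℝ := fun a => ρ (a.1 - a.2) * ψ a.1 with hΦdef
  have hΦ : ContDiff ℝ ∞ Φ :=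
    (hρ.comp (contDiff_fst.sub contDiff_snd)).mul (hψ.smooth.comp contDiff_fst)
  have hΦc : HasCompactSupport Φ := by
    -- The support lies in the image of `supp ψ × supp ρ` under `(p, h) ↦ (p, p - h)`.
    refine HasCompactSupport.intro ((hψ.compact.isCompact.prod hρc.isCompact).image
      (f := fun b : (Space d × ℝ) × (Space d × ℝ) => (b.1, b.1 - b.2)) (by fun_prop))
      fun a ha => ?_
    by_contra h
    have h1 : a.1 ∈ tsupport ψ := subset_tsupport _ (right_ne_zero_of_mul h)
    have h2 : a.1 - a.2 ∈ tsupport ρ := subset_tsupport _ (left_ne_zero_of_mul h)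
    exact ha ⟨(a.1, a.1 - a.2), ⟨h1, h2⟩, by simp⟩
  have hΦ1 : ∀ q, tsupport (fun p => Φ (p, q)) ⊆ cylinder d T := fun q =>
    (tsupport_mul_subset_right).trans hψ.support_subset
  have hΦ2 : ∀ p, tsupport (fun q => Φ (p, q)) ⊆ cylinder d T := by
    intro p
    by_cases hp : p ∈ tsupport ψ
    · have hcl : IsClosed {q | p - q ∈ tsupport ρ} :=
        (isClosed_tsupport ρ).preimage (by fun_prop)
      have hsub : tsupport (fun q => Φ (p, q)) ⊆ {q | p - q ∈ tsupport ρ} :=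
        closure_minimal (fun q hq => subset_tsupport _ (left_ne_zero_of_mul hq)) hcl
      intro q hq
      have := hsupp p hp _ (hsub hq)
      rwa [sub_sub_cancel] at this
    · have : (fun q => Φ (p, q)) = 0 := by
        ext q
        simp [hΦdef, image_eq_zero_of_notMem_tsupport hp]
      rw [this, tsupport_zero]
      exact empty_subset _
  obtain ⟨e, he, h⟩ := hU.doubling hν hf hA hAmono hA0 hV hΦ hΦc
    (fun a => mul_nonneg (hρ0 _) (hψ.nonneg _)) hΦ1 hΦ2
  obtain ⟨B, hB⟩ := hψ.compact.exists_bound_of_continuous hψ.smooth.continuous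
  have hρi : Integrable ρ := hρ.continuous.integrable_of_hasCompactSupport hρc
  have hmain := integrable_abs_sub_mul_mollifier hU.integrable hV.integrable hU.measurable
    hV.measurable hρi hρ.continuous.measurable
  have hDi : Integrable fun a : (Space d × ℝ) × (Space d × ℝ) =>
      |A (U a.1) - A (V a.2)| * ρ (a.1 - a.2) := by
    refine (hmain.const_mul (LA : ℝ)).mono' ?_ (ae_of_all _ fun a => ?_)
    · have h1 := hA.continuous.measurable.comp hU.measurable
      have h2 := hA.continuous.measurable.comp hV.measurable
      have h3 := hρ.continuous.measurable
      exact (((h1.comp measurable_fst).sub (h2.comp measurable_snd)).norm.mul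
        (h3.comp (measurable_fst.sub measurable_snd))).aestronglyMeasurable
    · rw [norm_mul, Real.norm_eq_abs, Real.norm_eq_abs, abs_abs, abs_of_nonneg (hρ0 _),
        ← mul_assoc]
      exact mul_le_mul_of_nonneg_right (abs_comp_sub_le hA _ _) (hρ0 _)
  have hbound : ∀ r ∈ Ioo (0 : ℝ) 1, (∫ a : (Space d × ℝ) × (Space d × ℝ),
        |A (U a.1) - A (V a.2)| *
          ∫ z in {z : Space d | r < ‖z‖}, (Φ (a - ((z, 0), (z, 0))) - Φ a) ∂ν) ≤
      (∫ z, k z ∂ν) * ∫ a : (Space d × ℝ) × (Space d × ℝ),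
        |A (U a.1) - A (V a.2)| * ρ (a.1 - a.2) := by
    intro r hr
    rw [← integral_const_mul]
    refine (le_abs_self _).trans ?_
    rw [← Real.norm_eq_abs]
    refine norm_integral_le_of_norm_le (hDi.const_mul _) (ae_of_all _ fun a => ?_)
    -- A jump by `(z, z)` preserves `p - q`, so `ρ` factors out and only `ψ` is differenced.
    have e1 : ∀ z : Space d, Φ (a - ((z, 0), (z, 0))) - Φ a =
        ρ (a.1 - a.2) * (ψ (a.1 - (z, 0)) - ψ a.1) := by
      intro z
      simp only [hΦdef, Prod.fst_sub, Prod.snd_sub, sub_sub_sub_cancel_right]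
      ring
    simp only [e1]
    rw [integral_const_mul, norm_mul, norm_mul, Real.norm_eq_abs, Real.norm_eq_abs,
      Real.norm_eq_abs, abs_abs, abs_of_nonneg (hρ0 _)]
    have h3 := abs_integral_outer_le hν hψ.smooth.continuous hB hk hψk hr.1 a.1
    have h4 : 0 ≤ |A (U a.1) - A (V a.2)| * ρ (a.1 - a.2) := mul_nonneg (abs_nonneg _) (hρ0 _)
    calc _ = |A (U a.1) - A (V a.2)| * ρ (a.1 - a.2) *
          |∫ z in {z : Space d | r < ‖z‖}, (ψ (a.1 - (z, 0)) - ψ a.1) ∂ν| := by ring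
      _ ≤ |A (U a.1) - A (V a.2)| * ρ (a.1 - a.2) * ∫ z, k z ∂ν := by gcongr
      _ = _ := by ring
  simp only [hΦdef, fderiv_mollified (hρ.differentiable (by simp))
    (hψ.smooth.differentiable (by simp))] at h
  set X := (∫ a : (Space d × ℝ) × (Space d × ℝ),
        ρ (a.1 - a.2) * fderiv ℝ ψ a.1 (fluxVec f (V a.2) (U a.1))) +
      (∫ z, k z ∂ν) * ∫ a : (Space d × ℝ) × (Space d × ℝ),
        |A (U a.1) - A (V a.2)| * ρ (a.1 - a.2) with hX
  have hlim : Tendsto (fun r => X + e r) (𝓝[>] 0) (𝓝 X) := by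
    simpa using he.const_add X
  refine ge_of_tendsto hlim ?_
  filter_upwards [Ioo_mem_nhdsGT one_pos] with r hr
  have h1 := h r hr
  have h2 := hbound r hr
  simp only [hΦdef] at h2
  linarith

end Mollified

/-! ### Dilated space cutoffs -/

section Cutoff

variable {d : ℕ} {T : ℝ} {Θ : ℝ → ℝ} {χ : Space d → ℝ}

/-- The space cutoff at scale `1/ε` times a function of time. -/
def cutoff (χ : Space d → ℝ) (Θ : ℝ → ℝ) (ε : ℝ) (p : Space d × ℝ) : ℝ := χ (ε • p.1) * Θ p.2

lemma tsupport_cutoff_subset (ε : ℝ) : tsupport (cutoff χ Θ ε) ⊆ univ ×ˢ tsupport Θ := by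
  refine closure_minimal (fun p hp => ⟨mem_univ _, subset_tsupport _ ?_⟩)
    (isClosed_univ.prod (isClosed_tsupport Θ))
  exact right_ne_zero_of_mul hp

lemma contDiff_cutoff (hχ : ContDiff ℝ ∞ χ) (hΘ : ContDiff ℝ ∞ Θ) (ε : ℝ) :
    ContDiff ℝ ∞ (cutoff χ Θ ε) := by
  unfold cutoff
  fun_prop

lemma isNonnegTest_cutoff (hχ : ContDiff ℝ ∞ χ) (hχc : HasCompactSupport χ) (hχ0 : ∀ x, 0 ≤ χ x)
    (hΘ : ContDiff ℝ ∞ Θ) (hΘc : HasCompactSupport Θ) (hΘ0 : ∀ t, 0 ≤ Θ t)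
    (hΘs : tsupport Θ ⊆ Ioo 0 T) {ε : ℝ} (hε : 0 < ε) : IsNonnegTest T (cutoff χ Θ ε) where
  smooth := contDiff_cutoff hχ hΘ ε
  compact := by
    refine HasCompactSupport.intro ((hχc.isCompact.prod hΘc.isCompact).image
      (f := fun b : Space d × ℝ => (ε⁻¹ • b.1, b.2)) (by fun_prop)) fun p hp => ?_
    by_contra h
    refine hp ⟨(ε • p.1, p.2), ⟨subset_tsupport _ (left_ne_zero_of_mul h),
      subset_tsupport _ (right_ne_zero_of_mul h)⟩, ?_⟩
    simp [smul_smul, inv_mul_cancel₀ hε.ne']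
  support_subset := (tsupport_cutoff_subset ε).trans (prod_mono subset_rfl hΘs)
  nonneg p := mul_nonneg (hχ0 _) (hΘ0 _)

lemma secondDiff_cutoff (ε : ℝ) (p : Space d × ℝ) (z : Space d) :
    secondDiff (cutoff χ Θ ε) p (z, 0) = Θ p.2 * secondDiff χ (ε • p.1) (ε • z) := by
  simp only [secondDiff, cutoff, Prod.fst_add, Prod.snd_add, Prod.fst_sub, Prod.snd_sub, add_zero,
    sub_zero, smul_add, smul_sub]
  ring

lemma fderiv_cutoff (hχ : Differentiable ℝ χ) (hΘ : Differentiable ℝ Θ) (ε : ℝ)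
    (p w : Space d × ℝ) :
    fderiv ℝ (cutoff χ Θ ε) p w =
      ε * Θ p.2 * fderiv ℝ χ (ε • p.1) w.1 + χ (ε • p.1) * (deriv Θ p.2 * w.2) := by
  have h1 : HasFDerivAt (fun p : Space d × ℝ => χ (ε • p.1))
      ((fderiv ℝ χ (ε • p.1)).comp (ε • ContinuousLinearMap.fst ℝ _ _)) p :=
    HasFDerivAt.comp (g := χ) p (hχ _).hasFDerivAt (hasFDerivAt_fst.const_smul ε)
  have h2 : HasFDerivAt (fun p : Space d × ℝ => Θ p.2)
      ((fderiv ℝ Θ p.2).comp (ContinuousLinearMap.snd ℝ _ _)) p :=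
    HasFDerivAt.comp (g := Θ) p (hΘ _).hasFDerivAt hasFDerivAt_snd
  have h3 : fderiv ℝ (cutoff χ Θ ε) p = _ := (h1.mul h2).fderiv
  rw [h3]
  simp [fderiv_eq_smul_deriv]
  ring

/-- Dominated convergence with majorant a multiple of `min 1 |z|²`. The quadratic bound governs
small jumps; the cap `2` is needed for large ones, where `|z|²` need not be integrable. -/
lemma tendsto_integral_min_scaled {ν : Measure (Space d)}
    (hν : Integrable (fun z => min 1 (‖z‖ ^ 2)) ν) {B C : ℝ} (hB : 0 ≤ B) (hC : 0 ≤ C)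
    {ε : ℕ → ℝ} (hε : Tendsto ε atTop (𝓝 0)) (hε1 : ∀ n, |ε n| ≤ 1) :
    (∀ n, Integrable (fun z => B * min 2 (C * (ε n ^ 2 * ‖z‖ ^ 2))) ν) ∧
      Tendsto (fun n => ∫ z, B * min 2 (C * (ε n ^ 2 * ‖z‖ ^ 2)) ∂ν) atTop (𝓝 0) := by
  have hdom := hν.const_mul (B * max 2 C)
  have hle : ∀ n, ∀ z : Space d, ‖B * min 2 (C * (ε n ^ 2 * ‖z‖ ^ 2))‖ ≤
      B * max 2 C * min 1 (‖z‖ ^ 2) := by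
    intro n z
    have h1 : ε n ^ 2 ≤ 1 := (sq_le_one_iff_abs_le_one _).2 (hε1 n)
    rw [Real.norm_of_nonneg (by positivity), mul_assoc]
    gcongr
    rw [mul_min_of_nonneg _ _ (by positivity), mul_one]
    refine min_le_min (le_max_left _ _) ?_
    calc C * (ε n ^ 2 * ‖z‖ ^ 2) ≤ C * (1 * ‖z‖ ^ 2) := by gcongr
      _ ≤ max 2 C * ‖z‖ ^ 2 := by rw [one_mul]; gcongr; exact le_max_right _ _
  have hm : ∀ n, AEStronglyMeasurable (fun z => B * min 2 (C * (ε n ^ 2 * ‖z‖ ^ 2))) ν := fun n =>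
    Continuous.aestronglyMeasurable (by fun_prop)
  refine ⟨fun n => hdom.mono' (hm n) (ae_of_all _ (hle n)), ?_⟩
  have := tendsto_integral_of_dominated_convergence (μ := ν)
    (F := fun n z => B * min 2 (C * (ε n ^ 2 * ‖z‖ ^ 2))) (f := fun _ => 0) _ hm hdom
    (fun n => ae_of_all _ (hle n)) (ae_of_all _ fun z => ?_)
  · simpa using this
  · have h1 : Tendsto (fun n => B * min 2 (C * (ε n ^ 2 * ‖z‖ ^ 2))) atTop
        (𝓝 (B * min 2 (C * (0 ^ 2 * ‖z‖ ^ 2)))) :=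
      (tendsto_const_nhds.min (((hε.pow 2).mul_const _).const_mul C)).const_mul B
    simpa using h1

end Cutoff

/-! ### Removing the space cutoff -/

section SpaceLimit

variable {d : ℕ} {T : ℝ} {f : ℝ → Space d} {Lf : ℝ≥0}
  {A : ℝ → ℝ} {LA : ℝ≥0} {U V ρ : Space d × ℝ → ℝ} {Θ : ℝ → ℝ}

/-- Removing the space cutoff in the doubled inequality: only the time derivative survives. -/
theorem IsKruzkov.integral_mollified_nonneg {ν : Measure (Space d)} [SFinite ν]
    [ν.IsNegInvariant] (hν : Integrable (fun z => min 1 (‖z‖ ^ 2)) ν)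
    (hf : LipschitzWith Lf f) (hA : LipschitzWith LA A) (hAmono : Monotone A) (hA0 : A 0 = 0)
    (hU : IsKruzkov ν T f A U) (hV : IsKruzkov ν T f A V)
    (hρ : ContDiff ℝ ∞ ρ) (hρc : HasCompactSupport ρ) (hρ0 : ∀ p, 0 ≤ ρ p)
    (hΘ : ContDiff ℝ ∞ Θ) (hΘc : HasCompactSupport Θ) (hΘ0 : ∀ t, 0 ≤ Θ t)
    (hΘs : tsupport Θ ⊆ Ioo 0 T)
    (hsupp : ∀ t ∈ tsupport Θ, ∀ h ∈ tsupport ρ, t - h.2 ∈ Ioo 0 T) :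
    0 ≤ ∫ a : (Space d × ℝ) × (Space d × ℝ),
      deriv Θ a.1.2 * (|U a.1 - V a.2| * ρ (a.1 - a.2)) := by
  let χ : ContDiffBump (0 : Space d) := ⟨1, 2, one_pos, one_lt_two⟩
  have hχ : ContDiff ℝ ∞ (χ : Space d → ℝ) := χ.contDiff
  have hχd : Differentiable ℝ (χ : Space d → ℝ) := hχ.differentiable (by simp)
  have hΘd : Differentiable ℝ Θ := hΘ.differentiable (by simp)
  have hχ1 : ∀ x, |χ x| ≤ 1 := fun x => by rw [abs_of_nonneg χ.nonneg]; exact χ.le_one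
  obtain ⟨C, hC0, hC⟩ := exists_abs_secondDiff_le hχ χ.hasCompactSupport
  obtain ⟨B, hB⟩ := hΘc.exists_bound_of_continuous hΘ.continuous
  have hB0 : 0 ≤ B := (norm_nonneg _).trans (hB 0)
  obtain ⟨B', hB'⟩ := hΘc.deriv.exists_bound_of_continuous (hΘ.continuous_deriv (by simp))
  obtain ⟨G, hG⟩ := (χ.hasCompactSupport.fderiv ℝ).exists_bound_of_continuous
    (hχ.continuous_fderiv (by simp))
  have hG0 : 0 ≤ G := (norm_nonneg _).trans (hG 0)
  have hB'0 : 0 ≤ B' := (norm_nonneg _).trans (hB' 0)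
  set ε : ℕ → ℝ := fun n => 1 / ((n : ℝ) + 1) with hεdef
  have hε : Tendsto ε atTop (𝓝 0) := tendsto_one_div_add_atTop_nhds_zero_nat
  have hεpos : ∀ n, 0 < ε n := fun n => Nat.one_div_pos_of_nat
  have hε1 : ∀ n, ε n ≤ 1 := fun n => by
    rw [hεdef]; exact div_le_one_of_le₀ (by simp) (by positivity)
  obtain ⟨hki, hkt⟩ := tendsto_integral_min_scaled hν hB0 hC0 hε
    fun n => by rw [abs_of_pos (hεpos n)]; exact hε1 n
  have hsd : ∀ n p z, |secondDiff (cutoff χ Θ (ε n)) p (z, 0)| ≤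
      B * min 2 (C * (ε n ^ 2 * ‖z‖ ^ 2)) := by
    intro n p z
    rw [secondDiff_cutoff, abs_mul]
    -- The bound `2` comes from `|χ| ≤ 1`, the quadratic one from smoothness of `χ`, dilation
    -- contributing `ε²`.
    refine mul_le_mul (hB _) (le_min ?_ ?_) (abs_nonneg _) hB0
    · have h1 := abs_le.1 (hχ1 (ε n • p.1 + ε n • z))
      have h2 := abs_le.1 (hχ1 (ε n • p.1 - ε n • z))
      have h3 := abs_le.1 (hχ1 (ε n • p.1))
      rw [secondDiff, abs_le]
      constructor <;> linarith
    · refine (hC _ _).trans_eq ?_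
      rw [norm_smul, mul_pow, Real.norm_eq_abs, sq_abs]
  have hρi : Integrable ρ := hρ.continuous.integrable_of_hasCompactSupport hρc
  have hmain := integrable_abs_sub_mul_mollifier hU.integrable hV.integrable hU.measurable
    hV.measurable hρi hρ.continuous.measurable
  have hineq : ∀ n, 0 ≤ (∫ a : (Space d × ℝ) × (Space d × ℝ), ρ (a.1 - a.2) *
        fderiv ℝ (cutoff χ Θ (ε n)) a.1 (fluxVec f (V a.2) (U a.1))) +
      (∫ z, B * min 2 (C * (ε n ^ 2 * ‖z‖ ^ 2)) ∂ν) *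
        ∫ a : (Space d × ℝ) × (Space d × ℝ), |A (U a.1) - A (V a.2)| * ρ (a.1 - a.2) := by
    intro n
    refine hU.mollified hν hf hA hAmono hA0 hV hρ hρc hρ0
      (isNonnegTest_cutoff hχ χ.hasCompactSupport (fun x => χ.nonneg) hΘ hΘc hΘ0 hΘs (hεpos n))
      ?_ (hki n) (hsd n)
    intro p hp h hh
    exact ⟨mem_univ _, hsupp _ (tsupport_cutoff_subset _ hp).2 h hh⟩
  have hlim : Tendsto (fun n => ∫ a : (Space d × ℝ) × (Space d × ℝ), ρ (a.1 - a.2) *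
        fderiv ℝ (cutoff χ Θ (ε n)) a.1 (fluxVec f (V a.2) (U a.1))) atTop
      (𝓝 (∫ a : (Space d × ℝ) × (Space d × ℝ),
        deriv Θ a.1.2 * (|U a.1 - V a.2| * ρ (a.1 - a.2)))) := by
    refine tendsto_integral_of_dominated_convergence
      (fun a => (B * G + B') * (Lf + 1) * (|U a.1 - V a.2| * ρ (a.1 - a.2)))
      (fun n => ?_) (hmain.const_mul _) (fun n => ae_of_all _ fun a => ?_)
      (ae_of_all _ fun a => ?_)
    · have hcont : Continuous (fderiv ℝ (cutoff χ Θ (ε n))) :=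
        (contDiff_cutoff hχ hΘ _).continuous_fderiv (by simp)
      have hm : StronglyMeasurable fun a : (Space d × ℝ) × (Space d × ℝ) =>
          (fderiv ℝ (cutoff χ Θ (ε n)) a.1, fluxVec f (V a.2) (U a.1)) :=
        (hcont.comp continuous_fst).stronglyMeasurable.prodMk
          (measurable_fluxVec hf.continuous (hV.measurable.comp measurable_snd)
            (hU.measurable.comp measurable_fst)).stronglyMeasurable
      have hρm : Continuous fun a : (Space d × ℝ) × (Space d × ℝ) => ρ (a.1 - a.2) :=
        hρ.continuous.comp (continuous_fst.sub continuous_snd)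
      exact (hρm.stronglyMeasurable.mul
        (isBoundedBilinearMap_apply.continuous.comp_stronglyMeasurable hm)).aestronglyMeasurable
    · have hF := norm_fluxVec_le hf (V a.2) (U a.1)
      have h1 : ‖(fluxVec f (V a.2) (U a.1)).1‖ ≤ (Lf + 1) * |U a.1 - V a.2| :=
        (norm_fst_le _).trans hF
      have h2 : ‖(fluxVec f (V a.2) (U a.1)).2‖ ≤ (Lf + 1) * |U a.1 - V a.2| :=
        (norm_snd_le _).trans hF
      rw [fderiv_cutoff hχd hΘd, norm_mul, Real.norm_of_nonneg (hρ0 _)]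
      have h3 : ‖ε n * Θ a.1.2 * fderiv ℝ χ (ε n • a.1.1) (fluxVec f (V a.2) (U a.1)).1‖ ≤
          1 * B * (G * ((Lf + 1) * |U a.1 - V a.2|)) := by
        rw [norm_mul, norm_mul, Real.norm_of_nonneg (hεpos n).le]
        refine mul_le_mul (mul_le_mul (hε1 n) (hB _) (norm_nonneg _) zero_le_one) ?_
          (norm_nonneg _) (by positivity)
        exact ((fderiv ℝ χ (ε n • a.1.1)).le_opNorm _).trans
          (mul_le_mul (hG _) h1 (norm_nonneg _) hG0)
      have h4 : ‖χ (ε n • a.1.1) * (deriv Θ a.1.2 * (fluxVec f (V a.2) (U a.1)).2)‖ ≤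
          1 * (B' * ((Lf + 1) * |U a.1 - V a.2|)) := by
        rw [norm_mul, norm_mul]
        exact mul_le_mul (hχ1 _) (mul_le_mul (hB' _) h2 (norm_nonneg _) hB'0) (by positivity)
          zero_le_one
      calc _ ≤ ρ (a.1 - a.2) * (1 * B * (G * ((Lf + 1) * |U a.1 - V a.2|)) +
            1 * (B' * ((Lf + 1) * |U a.1 - V a.2|))) :=
            mul_le_mul_of_nonneg_left ((norm_add_le _ _).trans (add_le_add h3 h4)) (hρ0 _)
        _ = _ := by ring
    -- Pointwise, the gradient term carries a factor `ε` and vanishes, while `χ(εx) → χ(0) = 1`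
    -- leaves the time derivative.
    · have hsm : Tendsto (fun n => ε n • a.1.1) atTop (𝓝 0) := by
        simpa using hε.smul_const a.1.1
      have t1 : Tendsto (fun n => fderiv ℝ χ (ε n • a.1.1) (fluxVec f (V a.2) (U a.1)).1) atTop
          (𝓝 (fderiv ℝ χ 0 (fluxVec f (V a.2) (U a.1)).1)) :=
        (((hχ.continuous_fderiv (by simp)).clm_apply continuous_const).tendsto 0).comp hsm
      have t2 : Tendsto (fun n => χ (ε n • a.1.1)) atTop (𝓝 (χ 0)) :=
        (hχ.continuous.tendsto 0).comp hsm
      have hχ0 : χ 0 = 1 := χ.one_of_mem_closedBall (by simp [χ])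
      rw [hχ0] at t2
      have := ((((hε.mul_const (Θ a.1.2)).mul t1).add (t2.mul_const
        (deriv Θ a.1.2 * (fluxVec f (V a.2) (U a.1)).2))).const_mul (ρ (a.1 - a.2)))
      simp only [fderiv_cutoff hχd hΘd]
      convert this using 2
      simp only [fluxVec, eta]
      ring
  have htot := hlim.add (hkt.mul_const
    (∫ a : (Space d × ℝ) × (Space d × ℝ), |A (U a.1) - A (V a.2)| * ρ (a.1 - a.2)))
  rw [zero_mul, add_zero] at htot
  exact ge_of_tendsto' htot hineq

end SpaceLimit

/-! ### Concentrating the mollifier -/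

section Localization

variable {d : ℕ} {T : ℝ} {f : ℝ → Space d} {Lf : ℝ≥0}
  {A : ℝ → ℝ} {LA : ℝ≥0} {U V : Space d × ℝ → ℝ} {Θ : ℝ → ℝ}

/-- Continuity of translations in `L¹`. -/
lemma tendsto_integral_abs_translate_sub (hV : Integrable V) :
    Tendsto (fun h : Space d × ℝ => ∫ p, |V (p - h) - V p|) (𝓝 0) (𝓝 0) := by
  have hV1 : MemLp V 1 := memLp_one_iff_integrable.2 hV
  let g : C(Space d × ℝ, C(Space d × ℝ, Space d × ℝ)) :=
    (ContinuousMap.mk (fun a : (Space d × ℝ) × (Space d × ℝ) => a.2 - a.1) (by fun_prop)).curry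
  have hg : ∀ h, MeasurePreserving (g h) := fun h => measurePreserving_sub_right volume h
  have hcont : Continuous fun h => Lp.compMeasurePreserving (g h) (hg h) (hV1.toLp V) :=
    continuous_const.compMeasurePreservingLp g.continuous hg ENNReal.one_ne_top
  have h0 : Lp.compMeasurePreserving (g 0) (hg 0) (hV1.toLp V) = hV1.toLp V := by
    rw [Lp.toLp_compMeasurePreserving]
    congr 1
    ext p
    simp [g]
  have hnorm : Continuous fun h =>
      ‖Lp.compMeasurePreserving (g h) (hg h) (hV1.toLp V) - hV1.toLp V‖ :=
    (hcont.sub continuous_const).norm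
  have hlim := hnorm.tendsto 0
  simp only [h0, sub_self, norm_zero] at hlim
  refine hlim.congr fun h => ?_
  rw [Lp.toLp_compMeasurePreserving, ← MemLp.toLp_sub, Lp.norm_toLp,
    eLpNorm_one_eq_lintegral_enorm, ← integral_norm_eq_lintegral_enorm
      ((hV1.comp_measurePreserving (hg h)).1.sub hV1.1)]
  rfl

/-- The Kato inequality integrated in space: `∫ |U - V| Θ'(t) ≥ 0`. -/
theorem IsKruzkov.integral_deriv_mul_nonneg {ν : Measure (Space d)} [SFinite ν]
    [ν.IsNegInvariant] (hν : Integrable (fun z => min 1 (‖z‖ ^ 2)) ν)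
    (hf : LipschitzWith Lf f) (hA : LipschitzWith LA A) (hAmono : Monotone A) (hA0 : A 0 = 0)
    (hU : IsKruzkov ν T f A U) (hV : IsKruzkov ν T f A V)
    (hΘ : ContDiff ℝ ∞ Θ) (hΘc : HasCompactSupport Θ) (hΘ0 : ∀ t, 0 ≤ Θ t)
    (hΘs : tsupport Θ ⊆ Ioo 0 T) :
    0 ≤ ∫ p : Space d × ℝ, deriv Θ p.2 * |U p - V p| := by
  obtain ⟨B, hB⟩ := hΘc.deriv.exists_bound_of_continuous (hΘ.continuous_deriv (by simp))
  have hB0 : 0 ≤ B := (norm_nonneg _).trans (hB 0)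
  have hΘm : Measurable (deriv Θ) := (hΘ.continuous_deriv (by simp)).measurable
  have hUm := hU.measurable
  have hVm := hV.measurable
  -- After the substitution `h = p - q` the doubled integral is the average of `W` against `ρ`, and
  -- the goal is `W 0 ≥ 0`. Continuity of `W` at `0` is continuity of translations.
  set W : Space d × ℝ → ℝ := fun h => ∫ p : Space d × ℝ, deriv Θ p.2 * |U p - V (p - h)| with hW
  have hWi : ∀ h, Integrable fun p : Space d × ℝ => deriv Θ p.2 * |U p - V (p - h)| := fun h =>
    (hU.integrable.sub (hV.integrable.comp_sub_right h)).abs.bdd_mul (c := B)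
      (hΘm.comp measurable_snd).aestronglyMeasurable (ae_of_all _ fun p => hB p.2)
  have hWlim : Tendsto W (𝓝 0) (𝓝 (W 0)) := by
    rw [tendsto_iff_norm_sub_tendsto_zero]
    have hz := (tendsto_integral_abs_translate_sub hV.integrable).const_mul B
    rw [mul_zero] at hz
    refine squeeze_zero (fun h => norm_nonneg _) (fun h => ?_) hz
    rw [hW]
    simp only
    rw [← integral_sub (hWi h) (hWi 0), ← integral_const_mul]
    refine norm_integral_le_of_norm_le
      (((hV.integrable.comp_sub_right h).sub hV.integrable).abs.const_mul B)
      (ae_of_all _ fun p => ?_)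
    rw [← mul_sub, norm_mul, sub_zero]
    refine mul_le_mul (hB _) ?_ (norm_nonneg _) hB0
    refine (abs_abs_sub_abs_le _ _).trans_eq ?_
    rw [sub_sub_sub_cancel_left, abs_sub_comm]
  have hgoal : ∫ p : Space d × ℝ, deriv Θ p.2 * |U p - V p| = W 0 := by simp [hW]
  rw [hgoal]
  by_contra! hneg
  -- If `W 0 < 0`, an average over a small enough ball is at most `W 0 / 2 < 0`, a contradiction.
  -- Here `δ₁` keeps the shifted times in `(0, T)` and `δ₂` is the radius on which `W < W 0 / 2`.
  obtain ⟨δ₁, hδ₁, hδ₁T⟩ := hΘc.isCompact.exists_cthickening_subset_open isOpen_Ioo hΘs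
  obtain ⟨δ₂, hδ₂, hδ₂W⟩ := Metric.eventually_nhds_iff_ball.1
    (hWlim.eventually (gt_mem_nhds (by linarith : W 0 < W 0 / 2)))
  set δ := min δ₁ δ₂ / 2 with hδ
  have hδ0 : 0 < δ := by positivity
  have hδle₁ : δ < δ₁ := by
    have := min_le_left δ₁ δ₂; have : 0 < min δ₁ δ₂ := by positivity
    rw [hδ]; linarith
  have hδle₂ : δ < δ₂ := by
    have := min_le_right δ₁ δ₂; have : 0 < min δ₁ δ₂ := by positivity
    rw [hδ]; linarith
  let b : ContDiffBump (0 : Space d × ℝ) := ⟨δ / 2, δ, by positivity, by linarith⟩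
  set ρ : Space d × ℝ → ℝ := b.normed volume with hρ
  have hρi : Integrable ρ := b.integrable_normed
  have hρm : Measurable ρ := b.continuous_normed.measurable
  have hρ0 : ∀ p, 0 ≤ ρ p := b.nonneg_normed
  have hkey := hU.integral_mollified_nonneg hν hf hA hAmono hA0 hV (ρ := ρ) b.contDiff_normed
    b.hasCompactSupport_normed hρ0 hΘ hΘc hΘ0 hΘs (by
      intro t ht h hh
      rw [hρ, b.tsupport_normed_eq] at hh
      refine hδ₁T (Metric.mem_cthickening_of_dist_le _ t _ _ ht ?_)
      have h1 : ‖h‖ ≤ δ := by simpa using hh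
      rw [Real.dist_eq, sub_sub_cancel_left, abs_neg, ← Real.norm_eq_abs]
      exact ((norm_snd_le h).trans h1).trans hδle₁.le)
  have hint : Integrable fun a : (Space d × ℝ) × (Space d × ℝ) =>
      deriv Θ a.1.2 * (|U a.1 - V a.2| * ρ (a.1 - a.2)) :=
    (integrable_abs_sub_mul_mollifier hU.integrable hV.integrable hUm hVm hρi hρm).bdd_mul (c := B)
      (hΘm.comp (measurable_snd.comp measurable_fst)).aestronglyMeasurable
      (ae_of_all _ fun a => hB a.1.2)
  have hint' : Integrable (fun a : (Space d × ℝ) × (Space d × ℝ) =>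
      deriv Θ a.1.2 * (|U a.1 - V (a.1 - a.2)| * ρ a.2)) (volume.prod volume) := by
    have h1 : Integrable (fun a : (Space d × ℝ) × (Space d × ℝ) => U a.1 * ρ a.2)
      (volume.prod volume) := hU.integrable.mul_prod hρi
    have h2 : Integrable (fun a : (Space d × ℝ) × (Space d × ℝ) => ρ a.2 * V (a.1 - a.2))
      (volume.prod volume) := integrable_snd_mul_mollifier hρi hV.integrable
    have h3 : Integrable (fun a : (Space d × ℝ) × (Space d × ℝ) =>
        |U a.1 - V (a.1 - a.2)| * ρ a.2) (volume.prod volume) := by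
      refine (h1.sub h2).abs.congr (ae_of_all _ fun a => ?_)
      simp only [Pi.sub_apply]
      rw [mul_comm (ρ a.2), ← sub_mul, abs_mul, abs_of_nonneg (hρ0 _)]
    exact h3.bdd_mul (c := B) (hΘm.comp (measurable_snd.comp measurable_fst)).aestronglyMeasurable
      (ae_of_all _ fun a => hB a.1.2)
  have hfub : ∫ a : (Space d × ℝ) × (Space d × ℝ),
      deriv Θ a.1.2 * (|U a.1 - V a.2| * ρ (a.1 - a.2)) = ∫ h, W h * ρ h := by
    rw [Measure.volume_eq_prod (Space d × ℝ) (Space d × ℝ), integral_prod _ hint]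
    have h1 : ∀ p : Space d × ℝ, ∫ q, deriv Θ p.2 * (|U p - V q| * ρ (p - q)) =
        ∫ h, deriv Θ p.2 * (|U p - V (p - h)| * ρ h) := fun p => by
      rw [← integral_sub_left_eq_self (fun q => deriv Θ p.2 * (|U p - V q| * ρ (p - q))) volume p]
      simp only [sub_sub_cancel]
    simp only [h1]
    rw [integral_integral_swap hint']
    refine integral_congr_ae (ae_of_all _ fun h => ?_)
    simp only [hW]
    rw [← integral_mul_const]
    simp only [mul_assoc]
  rw [hfub] at hkey
  have hle : ∫ h, W h * ρ h ≤ ∫ h, W 0 / 2 * ρ h := by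
    have hi : Integrable fun h => W h * ρ h := by
      refine (hint'.integral_prod_right).congr (ae_of_all _ fun h => ?_)
      simp only [hW]
      rw [← integral_mul_const]
      simp only [mul_assoc]
    refine integral_mono hi (hρi.const_mul _) fun h => ?_
    by_cases hh : h ∈ Metric.ball (0 : Space d × ℝ) δ
    · exact mul_le_mul_of_nonneg_right (hδ₂W h (Metric.ball_subset_ball hδle₂.le hh)).le (hρ0 h)
    · have : ρ h = 0 := by
        by_contra hne
        have : h ∈ Function.support ρ := hne
        rw [hρ, b.support_normed_eq] at this
        exact hh this
      simp [this]
  rw [integral_const_mul, hρ, b.integral_normed] at hle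
  linarith

end Localization

/-! ### Monotonicity in time from the weak inequality -/

section Time

/-- A smooth transition from `0` to `1` on `[τ, τ + δ]`. -/
def smoothStep (τ δ t : ℝ) : ℝ := Real.smoothTransition ((t - τ) / δ)

variable {τ δ : ℝ}

lemma contDiff_smoothStep (τ δ : ℝ) : ContDiff ℝ ∞ (smoothStep τ δ) :=
  Real.smoothTransition.contDiff.comp ((contDiff_id.sub contDiff_const).div_const δ)

lemma smoothStep_eq_zero (hδ : 0 < δ) {t : ℝ} (ht : t ≤ τ) : smoothStep τ δ t = 0 :=
  Real.smoothTransition.zero_of_nonpos (div_nonpos_of_nonpos_of_nonneg (by linarith) hδ.le)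

lemma smoothStep_eq_one (hδ : 0 < δ) {t : ℝ} (ht : τ + δ ≤ t) : smoothStep τ δ t = 1 :=
  Real.smoothTransition.one_of_one_le ((one_le_div hδ).2 (by linarith))

lemma deriv_smoothStep_nonneg (hδ : 0 < δ) (t : ℝ) : 0 ≤ deriv (smoothStep τ δ) t := by
  refine Monotone.deriv_nonneg fun a b hab => Real.smoothTransition.monotone ?_
  gcongr

lemma deriv_smoothStep_eq_zero (hδ : 0 < δ) {t : ℝ} (ht : t ∉ Icc τ (τ + δ)) :
    deriv (smoothStep τ δ) t = 0 := by
  rw [mem_Icc, not_and_or, not_le, not_le] at ht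
  rcases ht with ht | ht
  · have : smoothStep τ δ =ᶠ[𝓝 t] fun _ => 0 := by
      filter_upwards [Iio_mem_nhds ht] with s hs using smoothStep_eq_zero hδ (le_of_lt hs)
    rw [this.deriv_eq, deriv_const]
  · have : smoothStep τ δ =ᶠ[𝓝 t] fun _ => 1 := by
      filter_upwards [Ioi_mem_nhds ht] with s hs using smoothStep_eq_one hδ (le_of_lt hs)
    rw [this.deriv_eq, deriv_const]

lemma continuous_deriv_smoothStep (τ δ : ℝ) : Continuous (deriv (smoothStep τ δ)) :=
  (contDiff_smoothStep τ δ).continuous_deriv (by simp)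

lemma integrable_deriv_smoothStep (hδ : 0 < δ) : Integrable (deriv (smoothStep τ δ)) :=
  (continuous_deriv_smoothStep τ δ).integrable_of_hasCompactSupport
    (HasCompactSupport.intro isCompact_Icc fun _ ht => deriv_smoothStep_eq_zero hδ ht)

lemma integral_deriv_smoothStep (hδ : 0 < δ) : ∫ t, deriv (smoothStep τ δ) t = 1 := by
  have h := integral_of_hasDerivAt_of_tendsto (f := smoothStep τ δ) (m := 0) (n := 1)
    (fun t => ((contDiff_smoothStep τ δ).differentiable (by simp) t).hasDerivAt)
    (integrable_deriv_smoothStep hδ) ?_ ?_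
  · simpa using h
  · refine tendsto_const_nhds.congr' ?_
    filter_upwards [eventually_le_atBot τ] with t ht using (smoothStep_eq_zero hδ ht).symm
  · refine tendsto_const_nhds.congr' ?_
    filter_upwards [eventually_ge_atTop (τ + δ)] with t ht using (smoothStep_eq_one hδ ht).symm

lemma integrable_deriv_smoothStep_mul (hδ : 0 < δ) {m : ℝ → ℝ}
    (hm : ContinuousOn m (Icc τ (τ + δ))) :
    Integrable fun t => deriv (smoothStep τ δ) t * m t := by
  rw [← integrableOn_iff_integrable_of_support_subset (s := Icc τ (τ + δ))]
  · exact ((continuous_deriv_smoothStep τ δ).continuousOn.mul hm).integrableOn_Icc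
  · intro t ht
    by_contra h
    exact ht (by simp [deriv_smoothStep_eq_zero hδ h])

/-- A continuous function with nonpositive distributional derivative is nonincreasing. -/
lemma le_of_integral_deriv_mul_nonneg {T : ℝ} {m : ℝ → ℝ} (hm : ContinuousOn m (Icc 0 T))
    (h : ∀ Θ : ℝ → ℝ, ContDiff ℝ ∞ Θ → HasCompactSupport Θ → (∀ t, 0 ≤ Θ t) →
      tsupport Θ ⊆ Ioo 0 T → 0 ≤ ∫ t, deriv Θ t * m t)
    {t₀ t₁ : ℝ} (h₀ : 0 < t₀) (h₀₁ : t₀ < t₁) (h₁ : t₁ < T) : m t₁ ≤ m t₀ := by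
  by_contra! hlt
  -- With a third of the gap, the average of `m` just after `t₁` still exceeds the one just after
  -- `t₀` by at least `ε`.
  obtain ⟨ε, hε⟩ : ∃ ε, ε = (m t₁ - m t₀) / 3 := ⟨_, rfl⟩
  have hε0 : 0 < ε := by rw [hε]; linarith
  have hcont : ∀ t ∈ Ioo 0 T, ContinuousAt m t := fun t ht =>
    (hm t (Ioo_subset_Icc_self ht)).continuousAt (Icc_mem_nhds ht.1 ht.2)
  obtain ⟨δ₀, hδ₀, hd₀⟩ := Metric.continuousAt_iff.1 (hcont t₀ ⟨h₀, h₀₁.trans h₁⟩) ε hε0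
  obtain ⟨δ₁, hδ₁, hd₁⟩ := Metric.continuousAt_iff.1 (hcont t₁ ⟨h₀.trans h₀₁, h₁⟩) ε hε0
  obtain ⟨δ, hδ, hδlt⟩ : ∃ δ, 0 < δ ∧ δ < min (min δ₀ δ₁) (T - t₁) :=
    exists_between (lt_min (lt_min hδ₀ hδ₁) (by linarith))
  rw [lt_min_iff, lt_min_iff] at hδlt
  obtain ⟨⟨hδlt₀, hδlt₁⟩, hδT⟩ := hδlt
  have hsd : ∀ τ, Differentiable ℝ (smoothStep τ δ) := fun τ =>
    (contDiff_smoothStep τ δ).differentiable (by simp)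
  have hi₀ := integrable_deriv_smoothStep_mul (τ := t₀) hδ
    (hm.mono (Icc_subset_Icc h₀.le (by linarith)))
  have hi₁ := integrable_deriv_smoothStep_mul (τ := t₁) hδ
    (hm.mono (Icc_subset_Icc (by linarith) (by linarith)))
  have hsup : Function.support (fun t => smoothStep t₀ δ t - smoothStep t₁ δ t) ⊆
      Icc t₀ (t₁ + δ) := by
    intro t ht
    by_contra hn
    rw [mem_Icc, not_and_or, not_le, not_le] at hn
    refine ht ?_
    rcases hn with hn | hn
    · simp [smoothStep_eq_zero hδ hn.le, smoothStep_eq_zero hδ (hn.le.trans h₀₁.le)]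
    · simp [smoothStep_eq_one hδ hn.le, smoothStep_eq_one hδ (by linarith : t₀ + δ ≤ t)]
  have hts : tsupport (fun t => smoothStep t₀ δ t - smoothStep t₁ δ t) ⊆ Icc t₀ (t₁ + δ) :=
    closure_minimal hsup isClosed_Icc
  -- This test function rises on `[t₀, t₀ + δ]` and falls on `[t₁, t₁ + δ]`, so its derivative
  -- compares two local averages of `m`; `δ < T - t₁` keeps its support inside `(0, T)`.
  have hineq := h (fun t => smoothStep t₀ δ t - smoothStep t₁ δ t)
    ((contDiff_smoothStep t₀ δ).sub (contDiff_smoothStep t₁ δ))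
    (HasCompactSupport.of_support_subset_isCompact isCompact_Icc hsup)
    (fun t => sub_nonneg.2 (Real.smoothTransition.monotone (by gcongr)))
    (hts.trans fun t ht => ⟨h₀.trans_le ht.1, ht.2.trans_lt (by linarith)⟩)
  have hder : ∀ t, deriv (fun t => smoothStep t₀ δ t - smoothStep t₁ δ t) t * m t =
      deriv (smoothStep t₀ δ) t * m t - deriv (smoothStep t₁ δ) t * m t := fun t => by
    have hds : deriv (fun t => smoothStep t₀ δ t - smoothStep t₁ δ t) t = _ :=
      ((hsd t₀ t).hasDerivAt.sub (hsd t₁ t).hasDerivAt).deriv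
    rw [hds, sub_mul]
  simp only [hder] at hineq
  rw [integral_sub hi₀ hi₁] at hineq
  have b₀ : ∫ t, deriv (smoothStep t₀ δ) t * m t ≤ ∫ t, deriv (smoothStep t₀ δ) t * (m t₀ + ε) := by
    refine integral_mono hi₀ ((integrable_deriv_smoothStep hδ).mul_const _) fun t => ?_
    by_cases ht : t ∈ Icc t₀ (t₀ + δ)
    · refine mul_le_mul_of_nonneg_left ?_ (deriv_smoothStep_nonneg hδ t)
      have := hd₀ (x := t) (by rw [Real.dist_eq, abs_lt]; constructor <;> linarith [ht.1, ht.2])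
      rw [Real.dist_eq, abs_lt] at this
      linarith [this.2]
    · simp [deriv_smoothStep_eq_zero hδ ht]
  have b₁ : ∫ t, deriv (smoothStep t₁ δ) t * (m t₁ - ε) ≤ ∫ t, deriv (smoothStep t₁ δ) t * m t := by
    refine integral_mono ((integrable_deriv_smoothStep hδ).mul_const _) hi₁ fun t => ?_
    by_cases ht : t ∈ Icc t₁ (t₁ + δ)
    · refine mul_le_mul_of_nonneg_left ?_ (deriv_smoothStep_nonneg hδ t)
      have := hd₁ (x := t) (by rw [Real.dist_eq, abs_lt]; constructor <;> linarith [ht.1, ht.2])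
      rw [Real.dist_eq, abs_lt] at this
      linarith [this.1]
    · simp [deriv_smoothStep_eq_zero hδ ht]
  rw [integral_mul_const, integral_deriv_smoothStep hδ] at b₀ b₁
  linarith

end Time

/-! ### Contraction and uniqueness -/

section Contraction

variable {d : ℕ} {T lam c : ℝ} {f : ℝ → Space d} {Lf : ℝ≥0} {A : ℝ → ℝ} {LA : ℝ≥0}
  {u₀ v₀ : Space d → ℝ} {u v : Space d → ℝ → ℝ}

/-- The `L¹` distance of two functions at time `t`. -/
def l1Dist (u v : Space d → ℝ → ℝ) (t : ℝ) : ℝ :=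
  (eLpNorm (fun x => u x t - v x t) 1 volume).toReal

lemma continuousOn_l1Dist (hu : MemCL1 T u) (hv : MemCL1 T v) :
    ContinuousOn (l1Dist u v) (Icc 0 T) := by
  rw [continuousOn_iff_continuous_domRestrict]
  refine ((continuous_l1Curve hu).sub (continuous_l1Curve hv)).norm.congr fun t => ?_
  exact norm_l1Curve_sub hu hv t

lemma l1Dist_eq_integral (hu : MemCL1 T u) (hv : MemCL1 T v) {t : ℝ} (ht : t ∈ Icc 0 T) :
    l1Dist u v t = ∫ x, |u x t - v x t| := by
  rw [l1Dist, eLpNorm_one_eq_lintegral_enorm]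
  exact (integral_norm_eq_lintegral_enorm ((hu.1 t ht).1.sub (hv.1 t ht).1)).symm

lemma eLpNorm_sub_lt_top (hu : MemCL1 T u) (hv : MemCL1 T v) {t : ℝ} (ht : t ∈ Icc 0 T) :
    eLpNorm (fun x => u x t - v x t) 1 volume < ⊤ :=
  ((hu.1 t ht).sub (hv.1 t ht)).2

/-- Fubini turns the space-time inequality for the representatives into one for the `L¹` distance,
as they agree with `u` and `v` on almost every slice. -/
theorem integral_deriv_mul_l1Dist_nonneg (hd : 0 < d) (hlam : lam ∈ Ioo (0 : ℝ) 2) (hc : 0 < c)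
    (hf : LipschitzWith Lf f) (hA : LipschitzWith LA A) (hAmono : Monotone A) (hA0 : A 0 = 0)
    (hu : IsEntropySolution c lam T f A u₀ u) (hv : IsEntropySolution c lam T f A v₀ v)
    {Θ : ℝ → ℝ} (hΘ : ContDiff ℝ ∞ Θ) (hΘc : HasCompactSupport Θ) (hΘ0 : ∀ t, 0 ≤ Θ t)
    (hΘs : tsupport Θ ⊆ Ioo 0 T) : 0 ≤ ∫ t, deriv Θ t * l1Dist u v t := by
  obtain ⟨U, hU, huU⟩ := hu.exists_isKruzkov hd hlam hc
  obtain ⟨V, hV, hvV⟩ := hv.exists_isKruzkov hd hlam hc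
  refine (hU.integral_deriv_mul_nonneg (integrable_min_levy hd hlam hc) hf hA hAmono hA0 hV
    hΘ hΘc hΘ0 hΘs).trans_eq ?_
  obtain ⟨B, hB⟩ := hΘc.deriv.exists_bound_of_continuous (hΘ.continuous_deriv (by simp))
  have hi : Integrable (fun p : Space d × ℝ => deriv Θ p.2 * |U p - V p|)
      (volume.prod volume) :=
    (hU.integrable.sub hV.integrable).abs.bdd_mul (c := B)
      ((hΘ.continuous_deriv (by simp)).measurable.comp measurable_snd).aestronglyMeasurable
      (ae_of_all _ fun p => hB p.2)
  rw [Measure.volume_eq_prod, integral_prod_symm _ hi]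
  refine integral_congr_ae ?_
  have h1 := (ae_restrict_iff' measurableSet_Ioo).1 (ae_ae_of_ae_cylinder huU)
  have h2 := (ae_restrict_iff' measurableSet_Ioo).1 (ae_ae_of_ae_cylinder hvV)
  filter_upwards [h1, h2] with t ht1 ht2
  simp only [integral_const_mul]
  by_cases ht : t ∈ Ioo 0 T
  · rw [l1Dist_eq_integral hu.memCL1 hv.memCL1 (Ioo_subset_Icc_self ht)]
    congr 1
    refine integral_congr_ae ?_
    filter_upwards [ht1 ht, ht2 ht] with x hx1 hx2
    rw [hx1, hx2]
  · have : deriv Θ t = 0 := by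
      by_contra hne
      exact ht (hΘs (support_deriv_subset hne))
    simp [this]

/-- The test functions vanish near `t = 0`, so the weak inequality compares positive times only; the
initial time is reached by letting `s → 0+` and using continuity in `L¹`. -/
theorem l1Dist_le_initial (hd : 0 < d) (hlam : lam ∈ Ioo (0 : ℝ) 2) (hc : 0 < c)
    (hf : LipschitzWith Lf f) (hA : LipschitzWith LA A) (hAmono : Monotone A) (hA0 : A 0 = 0)
    (hu : IsEntropySolution c lam T f A u₀ u) (hv : IsEntropySolution c lam T f A v₀ v)
    {t : ℝ} (ht : t ∈ Ioo 0 T) : l1Dist u v t ≤ l1Dist u v 0 := by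
  have hcont := continuousOn_l1Dist hu.memCL1 hv.memCL1
  have hT : 0 < T := ht.1.trans ht.2
  have hlim : Tendsto (l1Dist u v) (𝓝[>] 0) (𝓝 (l1Dist u v 0)) := by
    refine (hcont 0 ⟨le_rfl, hT.le⟩).mono_left ?_
    rw [← nhdsWithin_Ioo_eq_nhdsGT hT]
    exact nhdsWithin_mono _ Ioo_subset_Icc_self
  refine ge_of_tendsto hlim ?_
  filter_upwards [Ioo_mem_nhdsGT ht.1] with s hs
  exact le_of_integral_deriv_mul_nonneg hcont
    (fun Θ h1 h2 h3 h4 => integral_deriv_mul_l1Dist_nonneg hd hlam hc hf hA hAmono hA0 hu hv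
      h1 h2 h3 h4) hs.1 hs.2 ht.2

/-- `L¹`-contraction for entropy solutions. -/
theorem eLpNorm_sub_le_initial (hd : 0 < d) (hlam : lam ∈ Ioo (0 : ℝ) 2) (hc : 0 < c)
    (hf : LipschitzWith Lf f) (hA : LipschitzWith LA A) (hAmono : Monotone A) (hA0 : A 0 = 0)
    (hu : IsEntropySolution c lam T f A u₀ u) (hv : IsEntropySolution c lam T f A v₀ v)
    {t : ℝ} (ht : t ∈ Ioo 0 T) :
    eLpNorm (fun x => u x t - v x t) 1 volume ≤ eLpNorm (fun x => u₀ x - v₀ x) 1 volume := by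
  have h0 : (0 : ℝ) ∈ Icc 0 T := ⟨le_rfl, (ht.1.trans ht.2).le⟩
  have hinit : eLpNorm (fun x => u₀ x - v₀ x) 1 volume =
      eLpNorm (fun x => u x 0 - v x 0) 1 volume := by
    refine eLpNorm_congr_ae ?_
    filter_upwards [hu.initial, hv.initial] with x h1 h2
    rw [h1, h2]
  rw [hinit, ← ENNReal.toReal_le_toReal
    (eLpNorm_sub_lt_top hu.memCL1 hv.memCL1 (Ioo_subset_Icc_self ht)).ne
    (eLpNorm_sub_lt_top hu.memCL1 hv.memCL1 h0).ne]
  exact l1Dist_le_initial hd hlam hc hf hA hAmono hA0 hu hv ht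

/-- Entropy solutions with the same initial datum agree at every time. -/
theorem ae_eq_of_same_initial (hT : 0 < T) (hd : 0 < d) (hlam : lam ∈ Ioo (0 : ℝ) 2) (hc : 0 < c)
    (hf : LipschitzWith Lf f) (hA : LipschitzWith LA A) (hAmono : Monotone A) (hA0 : A 0 = 0)
    (hu : IsEntropySolution c lam T f A u₀ u) (hv : IsEntropySolution c lam T f A u₀ v)
    {t : ℝ} (ht : t ∈ Icc 0 T) : ∀ᵐ x, u x t = v x t := by
  have hin : ∀ s ∈ Ioo 0 T, l1Dist u v s = 0 := by
    intro s hs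
    have h := eLpNorm_sub_le_initial hd hlam hc hf hA hAmono hA0 hu hv hs
    simp only [sub_self, eLpNorm_zero'] at h
    rw [l1Dist, nonpos_iff_eq_zero.1 h, ENNReal.toReal_zero]
  have hz : l1Dist u v t = 0 := by
    -- The contraction covers only the open interval; the endpoints follow from continuity of the
    -- distance.
    have hcl : closure (Ioo 0 T) = Icc 0 T := closure_Ioo hT.ne
    have hEq : EqOn (l1Dist u v) (fun _ => 0) (Icc 0 T) :=
      EqOn.of_subset_closure (s := Ioo 0 T) hin (continuousOn_l1Dist hu.memCL1 hv.memCL1)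
        continuousOn_const Ioo_subset_Icc_self hcl.ge
    exact hEq ht
  have hzero : eLpNorm (fun x => u x t - v x t) 1 volume = 0 :=
    ((ENNReal.toReal_eq_zero_iff _).1 hz).resolve_right
      (eLpNorm_sub_lt_top hu.memCL1 hv.memCL1 ht).ne
  filter_upwards [(eLpNorm_eq_zero_iff ((hu.memCL1.1 t ht).1.sub (hv.memCL1.1 t ht).1)
    one_ne_zero).1 hzero] with x hx
  exact sub_eq_zero.1 hx

/-- Passing from almost every slice to almost every point requires a measurable set, and `{u = v}`
need not be one; the argument is run on the Borel representatives. -/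
theorem ae_cylinder_eq_of_same_initial (hT : 0 < T) (hd : 0 < d) (hlam : lam ∈ Ioo (0 : ℝ) 2)
    (hc : 0 < c) (hf : LipschitzWith Lf f) (hA : LipschitzWith LA A) (hAmono : Monotone A)
    (hA0 : A 0 = 0) (hu : IsEntropySolution c lam T f A u₀ u)
    (hv : IsEntropySolution c lam T f A u₀ v) :
    ∀ᵐ p ∂(volume.restrict (cylinder d T)), u p.1 p.2 = v p.1 p.2 := by
  obtain ⟨U, hU, huU⟩ := hu.exists_isKruzkov hd hlam hc
  obtain ⟨V, hV, hvV⟩ := hv.exists_isKruzkov hd hlam hc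
  have hms : MeasurableSet {p : Space d × ℝ | U (p.1, p.2) = V (p.1, p.2)} :=
    measurableSet_eq_fun hU.measurable hV.measurable
  have hUV : ∀ᵐ p ∂(volume.restrict (cylinder d T)), U p = V p := by
    rw [restrict_cylinder]
    refine (Measure.ae_prod_mem_iff_ae_ae_mem hms).2 ((Measure.ae_ae_comm hms).2 ?_)
    filter_upwards [ae_ae_of_ae_cylinder huU, ae_ae_of_ae_cylinder hvV,
      ae_restrict_mem measurableSet_Ioo] with t h1 h2 ht
    filter_upwards [h1, h2, ae_eq_of_same_initial hT hd hlam hc hf hA hAmono hA0 hu hv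
      (Ioo_subset_Icc_self ht)] with x hx1 hx2 hx3
    rw [← hx1, ← hx2, hx3]
  filter_upwards [huU, hvV, hUV] with p h1 h2 h3
  rw [h1, h2, h3]

end Contraction

end FracConvDiff

end

theorem mainTheorem1 {d : ℕ} (hd : 0 < d) (T : ℝ) (hT : 0 < T)
    (lam : ℝ) (hlam : lam ∈ Set.Ioo (0 : ℝ) 2) (c : ℝ) (hc : 0 < c)
    (f : ℝ → FracConvDiff.Space d) (Lf : ℝ≥0) (hf : LipschitzWith Lf f)
    (A : ℝ → ℝ) (LA : ℝ≥0) (hA : LipschitzWith LA A) (hAmono : Monotone A) (hA0 : A 0 = 0) :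
    (∀ (u₀ v₀ : FracConvDiff.Space d → ℝ) (u v : FracConvDiff.Space d → ℝ → ℝ),
      FracConvDiff.IsEntropySolution c lam T f A u₀ u →
      FracConvDiff.IsEntropySolution c lam T f A v₀ v →
      ∀ t ∈ Set.Ioo 0 T,
        eLpNorm (fun x => u x t - v x t) 1 volume ≤ eLpNorm (fun x => u₀ x - v₀ x) 1 volume) ∧
    (∀ (u₀ : FracConvDiff.Space d → ℝ) (u v : FracConvDiff.Space d → ℝ → ℝ),
      FracConvDiff.IsEntropySolution c lam T f A u₀ u →
      FracConvDiff.IsEntropySolution c lam T f A u₀ v →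
      (∀ᵐ p ∂(volume.restrict (FracConvDiff.cylinder d T)), u p.1 p.2 = v p.1 p.2) ∧
      ∀ t ∈ Set.Icc 0 T, ∀ᵐ x, u x t = v x t) := by
  refine ⟨fun u₀ v₀ u v hu hv t ht => ?_, fun u₀ u v hu hv => ⟨?_, fun t ht => ?_⟩⟩
  · exact FracConvDiff.eLpNorm_sub_le_initial hd hlam hc hf hA hAmono hA0 hu hv ht
  · exact FracConvDiff.ae_cylinder_eq_of_same_initial hT hd hlam hc hf hA hAmono hA0 hu hv
  · exact FracConvDiff.ae_eq_of_same_initial hT hd hlam hc hf hA hAmono hA0 hu hv ht
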